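/- Fix an integer $k\ge 1$ and a real $\varepsilon>0$. In the Matrix Rank Game with integer bias $b\ge 0$, the board is the set of all $k$-element subsets (edges) of $[n]=\{1,\dots,n\}$. Maker and Breaker alternate, Maker moving first: in each turn Maker claims one unclaimed edge, and then Breaker claims $b$ unclaimed edges (all remaining ones if fewer than $b$ are left), until all edges are claimed. Maker wins if the $0/1$ matrix over $GF(2)$ with $n$ rows, whose columns are the incidence vectors of Maker's edges, has full rank, meaning rank $n$ if $k$ is odd and rank $n-1$ if $k$ is even; otherwise Breaker wins. Let $N=\binom{n}{k-1}$ and write $b=\frac{\beta N}{\log n}$ with $\beta\in\mathbb{R}$. Then there is $n_0=n_0(k,\varepsilon)$ such that for all $n\ge n_0$ and all such $b$ and $\beta$: if $\beta\le 1-\varepsilon$, then Maker has a winning strategy, and if $\beta\ge 1+\varepsilon$, then Breaker has a winning strategy. -/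

import Mathlib

/-- The edges of the board claimed neither by Maker (`M`) nor by Breaker (`B`). -/
def freeEdges {α : Type*} [DecidableEq α] (board M B : Finset α) : Finset α :=
  board \ (M ∪ B)

/-- `F` is a legal turn of Breaker with bias `b`: Breaker claims exactly `b` free edges, or all
free edges if fewer than `b` are left. -/
def IsBreakerTurn {α : Type*} [DecidableEq α] (board : Finset α) (b : ℕ)
    (M B F : Finset α) : Prop :=
  F ⊆ freeEdges board M B ∧ F.card = min b (freeEdges board M B).card

/-- Maker, who is to move, has a winning strategy in the `(1 : b)` Maker-Breaker game from the
position in which Maker has claimed `M` and Breaker has claimed `B`. The game ends when every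
edge is claimed, and Maker wins if the set of her edges then satisfies `P`. -/
inductive MakerWinsFrom {α : Type*} [DecidableEq α] (board : Finset α) (b : ℕ)
    (P : Finset α → Prop) : Finset α → Finset α → Prop
  | finish (M B : Finset α) (hfree : freeEdges board M B = ∅) (hP : P M) :
      MakerWinsFrom board b P M B
  | round (M B : Finset α) (e : α) (he : e ∈ freeEdges board M B)
      (hwin : ∀ F : Finset α, IsBreakerTurn board b (insert e M) B F →
        MakerWinsFrom board b P (insert e M) (B ∪ F)) :
      MakerWinsFrom board b P M B

/-- Breaker has a winning strategy in the same game from the same position (Maker to move):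
`reply e` is Breaker's answer to Maker's move `e`. Breaker wins if, once every edge is claimed,
Maker's set of edges does not satisfy `P`. -/
inductive BreakerWinsFrom {α : Type*} [DecidableEq α] (board : Finset α) (b : ℕ)
    (P : Finset α → Prop) : Finset α → Finset α → Prop
  | finish (M B : Finset α) (hfree : freeEdges board M B = ∅) (hP : ¬ P M) :
      BreakerWinsFrom board b P M B
  | round (M B : Finset α) (hfree : (freeEdges board M B).Nonempty) (reply : α → Finset α)
      (hlegal : ∀ e ∈ freeEdges board M B, IsBreakerTurn board b (insert e M) B (reply e))
      (hwin : ∀ e ∈ freeEdges board M B,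
        BreakerWinsFrom board b P (insert e M) (B ∪ reply e)) :
      BreakerWinsFrom board b P M B

/-- The edge set of the complete `k`-uniform hypergraph on `n` vertices. -/
def completeHypergraph (n k : ℕ) : Finset (Finset (Fin n)) :=
  (Finset.univ : Finset (Fin n)).powersetCard k

/-- The vertex-edge incidence matrix over `GF(2)` of a set `M` of edges: the column of an edge
has a `1` in the rows of its vertices and a `0` everywhere else. -/
def incidenceMatrix {n : ℕ} (M : Finset (Finset (Fin n))) :
    Matrix (Fin n) {e : Finset (Fin n) // e ∈ M} (ZMod 2) :=
  Matrix.of fun i e => if i ∈ e.1 then 1 else 0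

/-- Full rank for `k`-uniform edges: rank `n` if `k` is odd, rank `n - 1` if `k` is even. -/
def HasFullRank (n k : ℕ) (M : Finset (Finset (Fin n))) : Prop :=
  (incidenceMatrix M).rank = if Odd k then n else n - 1

/-- Maker, who moves first, has a winning strategy in the Matrix Rank Game with bias `b`. -/
def MakerWinsMatrixRankGame (n k b : ℕ) : Prop :=
  MakerWinsFrom (completeHypergraph n k) b (HasFullRank n k) ∅ ∅

/-- Breaker has a winning strategy in the Matrix Rank Game with bias `b` (Maker moves first). -/
def BreakerWinsMatrixRankGame (n k b : ℕ) : Prop :=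
  BreakerWinsFrom (completeHypergraph n k) b (HasFullRank n k) ∅ ∅

/-!
Over `GF(2)`, the matrix has full rank if and only if every nonempty vertex set `S` (other than the whole
vertex set, for even `k`) meets one of Maker's edges in an odd number of vertices. Let
`N = n.choose (k - 1)`, which is asymptotically the degree of a vertex.

Breaker isolates a vertex (`breakerWins_of_box`). He fixes a set `X` of about `n ^ (1 - ε / 4)` vertices
and first claims all edges that meet `X` twice. Maker touches few vertices of `X` meanwhile, and from then
on each of her edges touches at most one vertex of `X`: the free edges at the untouched vertices are disjoint
boxes. Against `i` boxes Breaker takes `b / i` edges from each, so he exhausts a box as soon as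
`b * ∑ 1 / i`, about `(1 - ε / 4) * b * log n`, exceeds `N`.

Maker first serves every vertex twice, and then plays against the large sets `S`
(`makerWins_of_parameters`).

* Serving in time. A vertex is dangerous once a small fraction of its edges has been claimed; as the
  service takes at most `2 * n` rounds, there are only `O(n / log n)` dangerous vertices. So edges with two
  dangerous vertices are negligible, and every other edge endangers at most one vertex. For the sum of
  `exp (lam * degree)` over the dangerous vertices, a turn of Breaker adds at most `lam * b` times the
  greatest term, and Maker destroys nearly all of that term. The sum therefore does not grow if
  `lam * b < 1` (`exists_sum_dangerWeight_le`), which keeps all degrees below `(log n + O(1)) / lam < N`.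
* Small sets. A vertex that is served still has a positive fraction of its edges free. If the two
  edges of each vertex are chosen at random, the expected number of sets `S` of at most `c₀ * n` vertices,
  such that no `v ∈ S` has been served with an edge that meets `S` in `v` only, is less than one. The
  choice is derandomized by conditional expectations (`exists_sum_failureWeight_le`). For even `k` this
  also settles the complements of small sets.
* Large sets. There are at most `2 ^ n` of them, each is met oddly by at least a constant times `n ^ k`
  edges, and Breaker has claimed at most `(2 * n + 1) * b` edges so far. Beck's potential for biased games
  has much room to spare (`makerWinsFrom_of_hittingPotential`).
-/

open Finset

/-! ### Strategies from invariants -/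

/-- A property of positions with Maker to move that holds at the end only if Maker has won, and that
Maker can restore in every round, is a winning strategy for Maker. -/
theorem makerWinsFrom_of_invariant {α : Type*} [DecidableEq α] {board : Finset α} {b : ℕ}
    {P : Finset α → Prop} (Inv : Finset α → Finset α → Prop)
    (hfin : ∀ M B, Inv M B → freeEdges board M B = ∅ → P M)
    (hstep : ∀ M B, Inv M B → (freeEdges board M B).Nonempty → ∃ e ∈ freeEdges board M B,
      ∀ F, IsBreakerTurn board b (insert e M) B F → Inv (insert e M) (B ∪ F))
    (M B : Finset α) (h : Inv M B) : MakerWinsFrom board b P M B := by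
  induction hc : (freeEdges board M B).card using Nat.strong_induction_on generalizing M B with
  | _ c ih =>
    rcases (freeEdges board M B).eq_empty_or_nonempty with h0 | h0
    · exact .finish M B h0 (hfin M B h h0)
    · obtain ⟨e, he, hF⟩ := hstep M B h h0
      refine .round M B e he fun F hturn => ih _ ?_ _ _ (hF F hturn) rfl
      rw [← hc]
      apply card_lt_card
      rw [ssubset_iff_of_subset]
      · exact ⟨e, he, by simp [freeEdges]⟩
      · intro x; simp only [freeEdges, mem_sdiff, mem_union, mem_insert]; tauto

/-- The analogous principle for Breaker. Breaker may name fewer edges than a turn comprises: he fills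
the turn up with arbitrary free edges, so the invariant must tolerate extra edges of Breaker. -/
theorem breakerWinsFrom_of_invariant {α : Type*} [DecidableEq α] {board : Finset α} {b : ℕ}
    {P : Finset α → Prop} (Inv : Finset α → Finset α → Prop)
    (hfin : ∀ M B, Inv M B → freeEdges board M B = ∅ → ¬ P M)
    (hstep : ∀ M B, Inv M B → ∀ e ∈ freeEdges board M B, ∃ F₀ ⊆ freeEdges board (insert e M) B,
      F₀.card ≤ b ∧ ∀ F, F₀ ⊆ F → F ⊆ freeEdges board (insert e M) B → Inv (insert e M) (B ∪ F))
    (M B : Finset α) (h : Inv M B) : BreakerWinsFrom board b P M B := by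
  induction hc : (freeEdges board M B).card using Nat.strong_induction_on generalizing M B with
  | _ c ih =>
    rcases (freeEdges board M B).eq_empty_or_nonempty with h0 | h0
    · exact .finish M B h0 (hfin M B h h0)
    · have key : ∀ e, ∃ F, e ∈ freeEdges board M B →
          IsBreakerTurn board b (insert e M) B F ∧ Inv (insert e M) (B ∪ F) := by
        intro e
        by_cases he : e ∈ freeEdges board M B
        · obtain ⟨F₀, hsub, hcard, hF⟩ := hstep M B h e he
          obtain ⟨F, h1, h2, h3⟩ := exists_subsuperset_card_eq hsub
            (le_min hcard (card_le_card hsub)) (min_le_right b _)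
          exact ⟨F, fun _ => ⟨⟨h2, h3⟩, hF F h1 h2⟩⟩
        · exact ⟨∅, fun h => absurd h he⟩
      choose reply hreply using key
      refine .round M B h0 reply (fun e he => (hreply e he).1) fun e he =>
        ih _ ?_ _ _ (hreply e he).2 rfl
      rw [← hc]
      apply card_lt_card
      rw [ssubset_iff_of_subset]
      · exact ⟨e, he, by simp [freeEdges]⟩
      · intro x; simp only [freeEdges, mem_sdiff, mem_union, mem_insert]; tauto

/-! ### Full rank in terms of odd intersections -/

theorem transpose_incidenceMatrix_mulVec {n : ℕ} (M : Finset (Finset (Fin n)))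
    (x : Fin n → ZMod 2) (e : {e : Finset (Fin n) // e ∈ M}) :
    ((incidenceMatrix M).transpose.mulVec x) e = (#(e.1 ∩ univ.filter (x · ≠ 0)) : ZMod 2) := by
  have h2 : ∀ a : ZMod 2, a = if a ≠ 0 then 1 else 0 := by decide
  simp only [Matrix.mulVec, dotProduct, Matrix.transpose_apply, incidenceMatrix, Matrix.of_apply,
    ite_mul, one_mul, zero_mul]
  rw [← sum_filter, filter_mem_eq_inter, univ_inter, sum_congr rfl fun i _ => h2 (x i), ← sum_filter,
    sum_const, nsmul_eq_mul, mul_one]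
  congr 2
  ext i; simp

theorem rank_incidenceMatrix_add_finrank_ker {n : ℕ} (M : Finset (Finset (Fin n))) :
    (incidenceMatrix M).rank +
      Module.finrank (ZMod 2) (LinearMap.ker (incidenceMatrix M).transpose.mulVecLin) = n := by
  rw [← Matrix.rank_transpose, Matrix.rank, LinearMap.finrank_range_add_finrank_ker]
  simp

theorem mem_ker_transpose_incidenceMatrix {n : ℕ} (M : Finset (Finset (Fin n)))
    (x : Fin n → ZMod 2) :
    x ∈ LinearMap.ker (incidenceMatrix M).transpose.mulVecLin ↔
      ∀ e ∈ M, Even #(e ∩ univ.filter (x · ≠ 0)) := by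
  rw [LinearMap.mem_ker, Matrix.mulVecLin_apply, funext_iff]
  simp only [transpose_incidenceMatrix_mulVec, Pi.zero_apply, ZMod.natCast_eq_zero_iff_even,
    Subtype.forall]

/-- The left kernel of the incidence matrix consists of the indicators of the vertex sets that every
edge meets in an even number of vertices. -/
theorem hasFullRank_of_odd_inter {n k : ℕ} (hn : 1 ≤ n) {M : Finset (Finset (Fin n))}
    (hM : ∀ e ∈ M, #e = k)
    (h : ∀ S : Finset (Fin n), S.Nonempty → (S = univ → Odd k) → ∃ e ∈ M, Odd #(e ∩ S)) :
    HasFullRank n k M := by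
  have hrank := rank_incidenceMatrix_add_finrank_ker M
  unfold HasFullRank
  have hzero : ∀ x ∈ LinearMap.ker (incidenceMatrix M).transpose.mulVecLin,
      x = 0 ∨ (Even k ∧ x = 1) := by
    intro x hx
    rw [mem_ker_transpose_incidenceMatrix] at hx
    by_contra! hcon
    obtain ⟨e, he, hodd⟩ := h (univ.filter (x · ≠ 0))
      (by
        obtain ⟨i, hi⟩ := Function.ne_iff.1 hcon.1
        exact ⟨i, by simpa using hi⟩)
      (by
        intro hu
        by_contra hk
        refine hcon.2 (Nat.not_odd_iff_even.1 hk) (funext fun i => ?_)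
        have hi : i ∈ univ.filter (x · ≠ 0) := by rw [hu]; exact mem_univ i
        have h2 : ∀ a : ZMod 2, a ≠ 0 → a = 1 := by decide
        exact h2 _ (by simpa using hi))
    exact Nat.not_even_iff_odd.2 hodd (hx e he)
  split_ifs with hk
  · have : LinearMap.ker (incidenceMatrix M).transpose.mulVecLin = ⊥ := by
      rw [Submodule.eq_bot_iff]
      intro x hx
      rcases hzero x hx with h | h
      · exact h
      · exact absurd h.1 (Nat.not_even_iff_odd.2 hk)
    rw [this, finrank_bot] at hrank
    omega
  · have hne : (1 : Fin n → ZMod 2) ≠ 0 := fun h0 => by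
      have := congrFun h0 ⟨0, hn⟩
      simp at this
    have : LinearMap.ker (incidenceMatrix M).transpose.mulVecLin = Submodule.span (ZMod 2) {1} := by
      apply le_antisymm
      · intro x hx
        rcases hzero x hx with h | h
        · rw [h]; exact Submodule.zero_mem _
        · rw [h.2]; exact Submodule.mem_span_singleton_self _
      · rw [Submodule.span_singleton_le_iff_mem, mem_ker_transpose_incidenceMatrix]
        intro e he
        simpa [hM e he] using hk
    rw [this, finrank_span_singleton hne] at hrank
    omega

/-- An isolated vertex `v` puts the indicator of `v` into the left kernel. For even `k` the constant
vector lies there as well. -/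
theorem not_hasFullRank_of_isolated {n k : ℕ} (hn : 2 ≤ n) {M : Finset (Finset (Fin n))}
    (hM : ∀ e ∈ M, #e = k) (v : Fin n) (hv : ∀ e ∈ M, v ∉ e) : ¬ HasFullRank n k M := by
  have hrank := rank_incidenceMatrix_add_finrank_ker M
  unfold HasFullRank
  have hmem : (Pi.single v 1 : Fin n → ZMod 2) ∈
      LinearMap.ker (incidenceMatrix M).transpose.mulVecLin := by
    rw [mem_ker_transpose_incidenceMatrix]
    intro e he
    have : e ∩ univ.filter ((Pi.single v 1 : Fin n → ZMod 2) · ≠ 0) = ∅ := by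
      ext i
      simp only [mem_inter, mem_filter, mem_univ, true_and, notMem_empty, iff_false, not_and, not_not]
      intro hi
      exact Pi.single_eq_of_ne (by rintro rfl; exact hv e he hi) _
    simp [this]
  have hne : (Pi.single v 1 : Fin n → ZMod 2) ≠ 0 := by simp
  split_ifs with hk
  · intro h
    have h0 : Module.finrank (ZMod 2) (LinearMap.ker (incidenceMatrix M).transpose.mulVecLin) = 0 := by
      omega
    rw [Submodule.finrank_eq_zero] at h0
    rw [h0] at hmem
    exact hne ((Submodule.mem_bot _).1 hmem)
  · intro h
    have hone : (1 : Fin n → ZMod 2) ∈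
        LinearMap.ker (incidenceMatrix M).transpose.mulVecLin := by
      rw [mem_ker_transpose_incidenceMatrix]
      intro e he
      simpa [hM e he] using hk
    have h1 : Module.finrank (ZMod 2) (LinearMap.ker (incidenceMatrix M).transpose.mulVecLin) = 1 := by
      omega
    obtain ⟨c, hc⟩ := (finrank_eq_one_iff_of_nonzero' (⟨_, hmem⟩ :
      LinearMap.ker (incidenceMatrix M).transpose.mulVecLin)
      (by simp)).1 h1 ⟨_, hone⟩
    have hc' : c • (Pi.single v 1 : Fin n → ZMod 2) = 1 := congrArg Subtype.val hc
    obtain ⟨w, hw⟩ : ∃ w : Fin n, w ≠ v := by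
      have : Nontrivial (Fin n) := Fin.nontrivial_iff_two_le.2 hn
      exact exists_ne v
    have := congrFun hc' w
    simp [hw] at this

/-! ### Counting edges through given vertices -/

theorem mem_completeHypergraph {n k : ℕ} {e : Finset (Fin n)} :
    e ∈ completeHypergraph n k ↔ #e = k := by
  simp [completeHypergraph, mem_powersetCard]

theorem card_edges_through {n k : ℕ} (hk : 1 ≤ k) (v : Fin n) :
    #((completeHypergraph n k).filter (v ∈ ·)) = (n - 1).choose (k - 1) := by
  have := card_filter_powersetCard_subset {v} (univ : Finset (Fin n)) k (by simp) (by simpa)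
  simpa [completeHypergraph] using this

theorem card_edges_through_pair {n k : ℕ} (hk : 2 ≤ k) {u v : Fin n} (h : u ≠ v) :
    #((completeHypergraph n k).filter (fun e => u ∈ e ∧ v ∈ e)) = (n - 2).choose (k - 2) := by
  have := card_filter_powersetCard_subset {u, v} (univ : Finset (Fin n)) k (by simp)
    (by simpa [card_pair h])
  simpa [completeHypergraph, card_pair h, insert_subset_iff] using this

theorem card_edges_through_meeting {n k : ℕ} (hk : 2 ≤ k) (v : Fin n) (S : Finset (Fin n)) :
    #((completeHypergraph n k).filter (fun e => v ∈ e ∧ ∃ u ∈ S, u ≠ v ∧ u ∈ e)) ≤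
      #S * (n - 2).choose (k - 2) := by
  calc _ ≤ #((S.erase v).biUnion fun u =>
          (completeHypergraph n k).filter (fun e => u ∈ e ∧ v ∈ e)) := by
        apply card_le_card
        intro e he
        simp only [mem_filter, mem_biUnion, mem_erase] at he ⊢
        obtain ⟨h1, h2, u, h3, h4, h5⟩ := he
        exact ⟨u, ⟨h4, h3⟩, h1, h5, h2⟩
    _ ≤ #(S.erase v) * (n - 2).choose (k - 2) :=
        card_biUnion_le_card_mul _ _ _ fun u hu => (card_edges_through_pair hk (ne_of_mem_erase hu)).le
    _ ≤ _ := Nat.mul_le_mul_right _ (card_le_card (erase_subset _ _))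

/-! ### Breaker isolates a vertex -/

/-- Breaker's position in the box game on the vertices of `I`: no edge of Maker touches `I`, the boxes
of the free edges at the vertices of `I` are disjoint, and each box is so small that Breaker, who takes
an equal share out of every surviving box in each turn, exhausts a box before Maker has hit them all. -/
def IsBoxPosition (n k b : ℕ) (I : Finset (Fin n)) (M B : Finset (Finset (Fin n))) : Prop :=
  I.Nonempty ∧ (∀ v ∈ I, ∀ e ∈ M, v ∉ e) ∧
    (∀ e ∈ freeEdges (completeHypergraph n k) M B, #(e ∩ I) ≤ 1) ∧
    ∀ v ∈ I, #((freeEdges (completeHypergraph n k) M B).filter (v ∈ ·)) ≤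
      ∑ j ∈ range (#I - 1), b / (j + 1)

theorem freeEdges_anti {α : Type*} [DecidableEq α] {board M B M' B' : Finset α} (hM : M ⊆ M')
    (hB : B ⊆ B') : freeEdges board M' B' ⊆ freeEdges board M B :=
  sdiff_subset_sdiff Subset.rfl (union_subset_union hM hB)

theorem IsBoxPosition.exists_reply {n k b : ℕ} {I : Finset (Fin n)} {M B : Finset (Finset (Fin n))}
    (h : IsBoxPosition n k b I M B) {e : Finset (Fin n)}
    (he : e ∈ freeEdges (completeHypergraph n k) M B) :
    ∃ F₀ ⊆ freeEdges (completeHypergraph n k) (insert e M) B, #F₀ ≤ b ∧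
      ∀ F, F₀ ⊆ F → ∃ I', IsBoxPosition n k b I' (insert e M) (B ∪ F) := by
  obtain ⟨hne, hM, hfree, hbox⟩ := h
  have hanti : ∀ F, freeEdges (completeHypergraph n k) (insert e M) (B ∪ F) ⊆
      freeEdges (completeHypergraph n k) M B := fun F =>
    freeEdges_anti (subset_insert _ _) subset_union_left
  rcases Nat.lt_or_ge 1 #I with hI | hI
  · obtain ⟨I', hI', hcard, hdisj⟩ : ∃ I' ⊆ I, #I' = #I - 1 ∧ ∀ v ∈ I', v ∉ e := by
      rcases (e ∩ I).eq_empty_or_nonempty with h0 | ⟨v, hv⟩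
      · obtain ⟨v, hv⟩ := hne
        refine ⟨I.erase v, erase_subset _ _, card_erase_of_mem hv, fun w hw hwe => ?_⟩
        exact notMem_empty w (h0 ▸ mem_inter.2 ⟨hwe, mem_of_mem_erase hw⟩)
      · refine ⟨I.erase v, erase_subset _ _, card_erase_of_mem (mem_inter.1 hv).2, fun w hw hwe => ?_⟩
        exact ne_of_mem_erase hw (card_le_one.1 (hfree e he) w
          (mem_inter.2 ⟨hwe, mem_of_mem_erase hw⟩) v hv)
    have hsub : ∀ v, ∃ G ⊆ (freeEdges (completeHypergraph n k) (insert e M) B).filter (v ∈ ·),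
        #G = min (b / #I') #((freeEdges (completeHypergraph n k) (insert e M) B).filter (v ∈ ·)) :=
      fun v => exists_subset_card_eq (min_le_right _ _)
    choose G hG hGcard using hsub
    refine ⟨I'.biUnion G, biUnion_subset.2 fun v _ => (hG v).trans (filter_subset _ _), ?_, ?_⟩
    · calc #(I'.biUnion G) ≤ #I' * (b / #I') :=
            card_biUnion_le_card_mul _ _ _ fun v _ => (hGcard v).le.trans (min_le_left _ _)
        _ ≤ b := Nat.mul_div_le b _
    · intro F hF
      refine ⟨I', card_pos.1 (by omega), ?_, ?_, ?_⟩
      · intro v hv e' he'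
        rcases mem_insert.1 he' with rfl | h
        · exact hdisj v hv
        · exact hM v (hI' hv) e' h
      · intro e' he'
        exact (card_le_card (inter_subset_inter_left hI')).trans (hfree e' (hanti F he'))
      · intro v hv
        have h1 : (freeEdges (completeHypergraph n k) (insert e M) (B ∪ F)).filter (v ∈ ·) ⊆
            (freeEdges (completeHypergraph n k) (insert e M) B).filter (v ∈ ·) \ G v := by
          intro e' he'
          simp only [freeEdges, mem_filter, mem_sdiff, mem_union, not_or] at he' ⊢
          exact ⟨⟨⟨he'.1.1, he'.1.2.1, he'.1.2.2.1⟩, he'.2⟩,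
            fun hg => he'.1.2.2.2 (hF (mem_biUnion.2 ⟨v, hv, hg⟩))⟩
        have h2 := card_le_card h1
        rw [card_sdiff_of_subset (hG v), hGcard v] at h2
        have h3 : #((freeEdges (completeHypergraph n k) (insert e M) B).filter (v ∈ ·)) ≤
            ∑ j ∈ range (#I - 1), b / (j + 1) :=
          (card_le_card (filter_subset_filter _ (freeEdges_anti (subset_insert _ _) Subset.rfl))).trans
            (hbox v (hI' hv))
        have h4 : #I - 1 = (#I' - 1) + 1 := by omega
        rw [h4, sum_range_succ, show #I' - 1 + 1 = #I' by omega] at h3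
        omega
  · have hI1 : #I = 1 := le_antisymm hI hne.card_pos
    refine ⟨∅, empty_subset _, by simp, fun F _ => ⟨I, hne, ?_, ?_, ?_⟩⟩
    · intro v hv e' he'
      rcases mem_insert.1 he' with rfl | h
      · intro hve
        have := hbox v hv
        simp only [hI1, Nat.sub_self, range_zero, sum_empty, Nat.le_zero, card_eq_zero] at this
        exact notMem_empty e' (this ▸ mem_filter.2 ⟨he, hve⟩)
      · exact hM v hv e' h
    · exact fun e' he' => hfree e' (hanti F he')
    · exact fun v hv => (card_le_card (filter_subset_filter _ (hanti F))).trans (hbox v hv)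

/-- Breaker wins if he can, within `j` turns, claim all edges that meet `X` in at least two vertices,
and win the box game on the (at least `i`) vertices of `X` that Maker has not touched by then. -/
theorem breakerWins_of_box {n k b : ℕ} (hn : 2 ≤ n) (hk : 1 ≤ k) (X : Finset (Fin n)) (i j : ℕ)
    (hi : 1 ≤ i) (hX : i + k * j ≤ #X)
    (hE : #((completeHypergraph n k).filter (fun e => 2 ≤ #(e ∩ X))) ≤ j * b)
    (hbox : (n - 1).choose (k - 1) ≤ ∑ l ∈ range (i - 1), b / (l + 1)) :
    BreakerWinsMatrixRankGame n k b := by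
  set E := (completeHypergraph n k).filter (fun e => 2 ≤ #(e ∩ X)) with hEdef
  have toBox : ∀ M B : Finset (Finset (Fin n)), M ⊆ completeHypergraph n k → #M ≤ j →
      E \ (M ∪ B) = ∅ → ∃ I, IsBoxPosition n k b I M B := by
    intro M B hM hMj hempty
    have htouched : #(M.biUnion id) ≤ k * j := by
      calc #(M.biUnion id) ≤ #M * k := card_biUnion_le_card_mul _ _ _ fun e he =>
            (mem_completeHypergraph.1 (hM he)).le
        _ ≤ k * j := by rw [mul_comm]; exact Nat.mul_le_mul_left _ hMj
    have hcard : i ≤ #(X \ M.biUnion id) := by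
      have := le_card_sdiff (M.biUnion id) X
      omega
    refine ⟨X \ M.biUnion id, card_pos.1 (by omega), ?_, ?_, ?_⟩
    · intro v hv e he hve
      exact (mem_sdiff.1 hv).2 (mem_biUnion.2 ⟨e, he, hve⟩)
    · intro e he
      by_contra! hcon
      have : e ∈ E \ (M ∪ B) := mem_sdiff.2 ⟨mem_filter.2 ⟨(mem_sdiff.1 he).1,
        (Nat.succ_le_of_lt hcon).trans (card_le_card (inter_subset_inter_left sdiff_subset))⟩,
        (mem_sdiff.1 he).2⟩
      rw [hempty] at this
      exact notMem_empty _ this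
    · intro v _
      calc _ ≤ #((completeHypergraph n k).filter (v ∈ ·)) :=
            card_le_card (filter_subset_filter _ sdiff_subset)
        _ ≤ ∑ l ∈ range (i - 1), b / (l + 1) := by rwa [card_edges_through hk]
        _ ≤ _ := sum_le_sum_of_subset (range_subset_range.2 (by omega))
  refine breakerWinsFrom_of_invariant
    (fun M B => M ⊆ completeHypergraph n k ∧
      ((#M < j ∧ #(E \ (M ∪ B)) ≤ (j - #M) * b) ∨ ∃ I, IsBoxPosition n k b I M B)) ?_ ?_ ∅ ∅ ?_
  · rintro M B ⟨hM, hAB⟩ hfree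
    have : ∃ I, IsBoxPosition n k b I M B := by
      rcases hAB with ⟨h1, _⟩ | h
      · refine toBox M B hM h1.le ?_
        rw [← subset_empty, ← hfree]
        exact sdiff_subset_sdiff (filter_subset _ _) Subset.rfl
      · exact h
    obtain ⟨I, ⟨v, hv⟩, hI, _⟩ := this
    exact not_hasFullRank_of_isolated hn (fun e he => mem_completeHypergraph.1 (hM he)) v (hI v hv)
  · rintro M B ⟨hM, hAB⟩ e he
    have hM' : insert e M ⊆ completeHypergraph n k :=
      insert_subset (mem_sdiff.1 he).1 hM
    rcases hAB with ⟨h1, h2⟩ | ⟨I, hI⟩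
    · have heM : e ∉ M := fun h => (mem_sdiff.1 he).2 (mem_union_left _ h)
      have hcardM : #(insert e M) = #M + 1 := card_insert_of_notMem heM
      obtain ⟨F₀, hF₀, hF₀card⟩ := exists_subset_card_eq
        (min_le_right b #(E \ (insert e M ∪ B)))
      refine ⟨F₀, hF₀.trans (sdiff_subset_sdiff (filter_subset _ _) Subset.rfl),
        hF₀card.le.trans (min_le_left _ _), fun F hF _ => ⟨hM', ?_⟩⟩
      have h3 : #(E \ (insert e M ∪ (B ∪ F))) ≤ (j - (#M + 1)) * b := by
        have h4 : E \ (insert e M ∪ (B ∪ F)) ⊆ (E \ (insert e M ∪ B)) \ F₀ := by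
          intro x hx
          simp only [mem_sdiff, mem_union, not_or] at hx ⊢
          exact ⟨⟨hx.1, hx.2.1, hx.2.2.1⟩, fun h => hx.2.2.2 (hF h)⟩
        have h5 := card_le_card h4
        rw [card_sdiff_of_subset hF₀, hF₀card] at h5
        have h6 : #(E \ (insert e M ∪ B)) ≤ #(E \ (M ∪ B)) := card_le_card
          (sdiff_subset_sdiff Subset.rfl (union_subset_union (subset_insert _ _) Subset.rfl))
        have h7 : (j - #M) * b = (j - (#M + 1)) * b + b := by
          rw [← Nat.succ_mul]; congr 1; omega
        omega
      rcases Nat.lt_or_ge (#M + 1) j with hlt | hge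
      · exact Or.inl ⟨hcardM ▸ hlt, hcardM ▸ h3⟩
      · refine Or.inr (toBox _ _ hM' (by omega) ?_)
        rw [Nat.sub_eq_zero_of_le hge, zero_mul, Nat.le_zero, card_eq_zero] at h3
        exact h3
    · obtain ⟨F₀, hF₀, hc, hF⟩ := hI.exists_reply he
      exact ⟨F₀, hF₀, hc, fun F hF1 _ => ⟨hM', Or.inr (hF F hF1)⟩⟩
  · refine ⟨empty_subset _, ?_⟩
    rcases Nat.eq_zero_or_pos j with rfl | hj
    · refine Or.inr (toBox ∅ ∅ (empty_subset _) (by simp) ?_)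
      simpa using hE
    · exact Or.inl ⟨by simpa using hj, by simpa using hE⟩

theorem card_edges_meeting_twice_le {n k : ℕ} (hk : 2 ≤ k) (X : Finset (Fin n)) :
    #((completeHypergraph n k).filter (fun e => 2 ≤ #(e ∩ X))) ≤
      #X * #X * (n - 2).choose (k - 2) := by
  calc _ ≤ #(X.biUnion fun v => (completeHypergraph n k).filter
          (fun e => v ∈ e ∧ ∃ u ∈ X, u ≠ v ∧ u ∈ e)) := by
        apply card_le_card
        intro e he
        simp only [mem_filter, mem_biUnion] at he ⊢
        obtain ⟨u, hu, v, hv, huv⟩ := one_lt_card.1 he.2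
        rw [mem_inter] at hu hv
        exact ⟨v, hv.2, he.1, hv.1, u, hu.2, huv, hu.1⟩
    _ ≤ #X * (#X * (n - 2).choose (k - 2)) :=
        card_biUnion_le_card_mul _ _ _ fun v _ => card_edges_through_meeting hk v X
    _ = _ := by ring

/-! ### Binomial estimates -/

theorem le_choose_of_pos_of_lt {n r : ℕ} (hr : 1 ≤ r) (hrn : r < n) : n ≤ n.choose r := by
  induction n with
  | zero => omega
  | succ n ih =>
    obtain ⟨r, rfl⟩ : ∃ s, r = s + 1 := ⟨r - 1, by omega⟩
    rw [Nat.choose_succ_succ']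
    rcases Nat.lt_or_ge (r + 1) n with h | h
    · have := ih h
      have := Nat.choose_pos (show r ≤ n by omega)
      omega
    · have h1 : n = r + 1 := by omega
      subst h1
      simp

theorem mul_choose_pred_pred {n k : ℕ} (hn : 1 ≤ n) (hk : 2 ≤ k) :
    n * (n - 1).choose (k - 2) = (k - 1) * n.choose (k - 1) := by
  obtain ⟨n, rfl⟩ : ∃ m, n = m + 1 := ⟨n - 1, by omega⟩
  obtain ⟨k, rfl⟩ : ∃ m, k = m + 2 := ⟨k - 2, by omega⟩
  have := Nat.add_one_mul_choose_eq n k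
  rw [Nat.add_sub_cancel, Nat.add_sub_cancel, show k + 2 - 1 = k + 1 by omega, this, mul_comm]

theorem mul_choose_codegree_le {n k : ℕ} (hn : 1 ≤ n) (hk : 2 ≤ k) :
    n * (n - 2).choose (k - 2) ≤ (k - 1) * n.choose (k - 1) := by
  rw [← mul_choose_pred_pred hn hk]
  exact Nat.mul_le_mul_left _ (Nat.choose_le_choose _ (by omega))

/-- The rounding in the shares costs Breaker at most one edge per surviving box and turn. -/
theorem sum_div_succ_ge (b i : ℕ) (hi : 1 ≤ i) :
    (b : ℝ) * Real.log i - i ≤ ((∑ l ∈ range (i - 1), b / (l + 1) : ℕ) : ℝ) := by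
  have h1 := log_add_one_le_harmonic (i - 1)
  rw [show i - 1 + 1 = i by omega] at h1
  have h2 : (b : ℝ) * (harmonic (i - 1) : ℚ) - i ≤ ∑ l ∈ range (i - 1), ((b : ℝ) / (l + 1) - 1) := by
    rw [sum_sub_distrib, harmonic]
    push_cast
    rw [mul_sum]
    simp only [div_eq_mul_inv, sum_const, card_range, nsmul_eq_mul, mul_one]
    have : ((i - 1 : ℕ) : ℝ) ≤ i := by exact_mod_cast Nat.sub_le i 1
    linarith
  have h3 : ∑ l ∈ range (i - 1), ((b : ℝ) / (l + 1) - 1) ≤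
      ((∑ l ∈ range (i - 1), b / (l + 1) : ℕ) : ℝ) := by
    push_cast
    refine sum_le_sum fun l _ => ?_
    have := Nat.sub_one_lt_floor ((b : ℝ) / ((l + 1 : ℕ) : ℝ))
    rw [Nat.floor_div_eq_div] at this
    push_cast at this
    exact this.le
  have h4 : (b : ℝ) * Real.log i ≤ (b : ℝ) * (harmonic (i - 1) : ℚ) :=
    mul_le_mul_of_nonneg_left h1 (Nat.cast_nonneg b)
  linarith

/-! ### Breaker's side of the threshold -/

open Filter Topology in
theorem tendsto_log_mul_rpow_neg {η : ℝ} (hη : 0 < η) :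
    Tendsto (fun n : ℕ => Real.log n * (n : ℝ) ^ (-η)) atTop (𝓝 0) := by
  have h := (isLittleO_log_rpow_atTop hη).tendsto_div_nhds_zero.comp tendsto_natCast_atTop_atTop
  refine h.congr fun n => ?_
  simp only [Function.comp]
  rw [Real.rpow_neg (Nat.cast_nonneg n), div_eq_mul_inv]

set_option maxHeartbeats 1000000 in
open Filter Topology in
/-- With about `n ^ (1 - ε / 4)` candidates, Breaker needs so few turns to claim all edges that contain two
of them that most candidates stay untouched, while the logarithm of their number is still
`(1 - ε / 4) * log n` up to a constant. -/
theorem breakerWins_of_large_bias_of_two_le {k : ℕ} (hk : 2 ≤ k) {ε : ℝ} (hε : 0 < ε) (hε1 : ε ≤ 1) :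
    ∀ᶠ n : ℕ in atTop, ∀ b : ℕ, (1 + ε) * (n.choose (k - 1) : ℝ) / Real.log n ≤ b →
      BreakerWinsMatrixRankGame n k b := by
  have hη : 0 < ε / 4 := by positivity
  have hcast := tendsto_natCast_atTop_atTop (R := ℝ)
  have hk0 : (0 : ℝ) < k := by exact_mod_cast (by omega : 0 < k)
  have e1 : ∀ᶠ n : ℕ in atTop, (k : ℝ) * k * (Real.log n * (n : ℝ) ^ (-(ε / 4))) ≤ 1 / 4 := by
    have := (tendsto_log_mul_rpow_neg hη).const_mul ((k : ℝ) * k)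
    rw [mul_zero] at this
    exact this.eventually_le_const (by norm_num)
  have e2 : ∀ᶠ n : ℕ in atTop, (n : ℝ) ^ (-(ε / 4)) ≤ ε / 4 :=
    ((tendsto_rpow_neg_atTop hη).comp hcast).eventually_le_const hη
  have e3 : ∀ᶠ n : ℕ in atTop, (8 * k : ℝ) + 8 ≤ (n : ℝ) ^ (1 - ε / 4) :=
    ((tendsto_rpow_atTop (by linarith)).comp hcast).eventually_ge_atTop _
  have e4 : ∀ᶠ n : ℕ in atTop, 2 * Real.log 4 / (ε / 4) + 1 ≤ Real.log n :=
    (Real.tendsto_log_atTop.comp hcast).eventually_ge_atTop _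
  filter_upwards [e1, e2, e3, e4, eventually_ge_atTop (k + 2)] with n h1 h2 h3 h4 hn b hb
  have hlog4 : 0 < Real.log 4 := Real.log_pos (by norm_num)
  have hL : 0 < Real.log n := by
    have : 0 < 2 * Real.log 4 / (ε / 4) := by positivity
    linarith
  have hn0 : (0 : ℝ) < n := by exact_mod_cast (by omega : 0 < n)
  set N : ℝ := (n.choose (k - 1) : ℝ) with hN
  set κ : ℕ := (n - 2).choose (k - 2) with hκ
  set L := Real.log n with hLdef
  have hNn : (n : ℝ) ≤ N := by
    rw [hN]
    exact_mod_cast le_choose_of_pos_of_lt (show 1 ≤ k - 1 by omega) (show k - 1 < n by omega)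
  have hN0 : 0 < N := hn0.trans_le hNn
  have hκN : (n : ℝ) * κ ≤ k * N := by
    have h : (n * κ : ℕ) ≤ k * n.choose (k - 1) :=
      (mul_choose_codegree_le (by omega) hk).trans (Nat.mul_le_mul_right _ (Nat.sub_le _ _))
    rw [hN]
    exact_mod_cast h
  have hb0 : (0 : ℝ) < b := lt_of_lt_of_le (by positivity) hb
  have hbL : (1 + ε) * N ≤ b * L := by rwa [div_le_iff₀ hL] at hb
  have hNb : N ≤ b * L := by nlinarith
  set x : ℝ := (n : ℝ) ^ (1 - ε / 4) with hx
  set y : ℝ := (n : ℝ) ^ (-(ε / 4)) with hy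
  have hy0 : 0 < y := Real.rpow_pos_of_pos hn0 _
  have hxy : x = n * y := by
    rw [hx, hy, sub_eq_add_neg, Real.rpow_add hn0, Real.rpow_one]
  set m : ℕ := ⌊x⌋₊ with hm
  have hmx : (m : ℝ) ≤ x := Nat.floor_le (by rw [hxy]; positivity)
  have hxm : x - 1 < m := Nat.sub_one_lt_floor x
  have hmn : m ≤ n := by
    have : x ≤ n := by
      rw [hxy]
      have : y ≤ 1 := by linarith
      nlinarith
    exact_mod_cast hmx.trans this
  obtain ⟨X, -, hX⟩ := exists_subset_card_eq (s := (univ : Finset (Fin n))) (n := m) (by simpa using hmn)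
  set j : ℕ := m * m * κ / b + 1 with hj
  have hbpos : 0 < b := by exact_mod_cast hb0
  have hjreal : (j : ℝ) ≤ m * m * κ / b + 1 := by
    rw [hj]; push_cast
    have : ((m * m * κ / b : ℕ) : ℝ) ≤ ((m * m * κ : ℕ) : ℝ) / b := Nat.cast_div_le
    push_cast at this
    linarith
  have hkj : (k : ℝ) * j ≤ m / 2 := by
    have a1 : (κ : ℝ) / b ≤ k * L / n := by
      rw [div_le_div_iff₀ hb0 hn0]
      nlinarith
    have a2 : (m : ℝ) * m * κ / b ≤ m * (k * L * y) := by
      calc (m : ℝ) * m * κ / b = m * (m * (κ / b)) := by ring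
        _ ≤ m * (x * (k * L / n)) := by gcongr
        _ = m * (k * L * y) := by rw [hxy]; field_simp
    have a3 : (k : ℝ) * (m * (k * L * y)) ≤ m * (1 / 4) := by
      calc (k : ℝ) * (m * (k * L * y)) = m * (k * k * (L * y)) := by ring
        _ ≤ m * (1 / 4) := by gcongr
    have a4 : (k : ℝ) * j ≤ k * (m * (k * L * y) + 1) := by gcongr; linarith
    nlinarith
  have hkjm : k * j ≤ m := by
    have : ((k * j : ℕ) : ℝ) ≤ m := by push_cast; linarith [(Nat.cast_nonneg m : (0 : ℝ) ≤ m)]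
    exact_mod_cast this
  have hireal : x / 4 ≤ ((m - k * j : ℕ) : ℝ) := by
    rw [Nat.cast_sub hkjm]; push_cast; linarith
  have hi1 : 1 ≤ m - k * j := by
    have : (0 : ℝ) < ((m - k * j : ℕ) : ℝ) := by linarith
    exact_mod_cast this
  refine breakerWins_of_box (by omega) (by omega) X (m - k * j) j hi1 (by rw [hX]; omega) ?_ ?_
  · calc _ ≤ m * m * κ := by rw [← hX]; exact card_edges_meeting_twice_le hk X
      _ ≤ j * b := by
          have := Nat.lt_mul_div_succ (m * m * κ) hbpos
          rw [hj, mul_comm _ b]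
          exact this.le
  · have s1 := sum_div_succ_ge b (m - k * j) hi1
    have s2 : (1 - ε / 4) * L - Real.log 4 ≤ Real.log ((m - k * j : ℕ) : ℝ) := by
      have : Real.log (x / 4) = (1 - ε / 4) * L - Real.log 4 := by
        rw [Real.log_div (by linarith) (by norm_num), hx, Real.log_rpow hn0]
      rw [← this]
      exact Real.log_le_log (by linarith) hireal
    have s3 : ((m - k * j : ℕ) : ℝ) ≤ x :=
      le_trans (by exact_mod_cast Nat.sub_le _ _) hmx
    have s4 : Real.log 4 ≤ ε / 8 * L := by
      have : 2 * Real.log 4 / (ε / 4) ≤ L := by linarith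
      rw [div_le_iff₀ hη] at this
      linarith
    have s5 : x ≤ ε / 4 * N := by
      rw [hxy]; nlinarith
    have s6 : (b : ℝ) * ((1 - 3 * ε / 8) * L) ≤ b * Real.log ((m - k * j : ℕ) : ℝ) := by
      gcongr; linarith
    have s7 : (1 - 3 * ε / 8) * ((1 + ε) * N) ≤ (1 - 3 * ε / 8) * (b * L) := by
      gcongr; linarith
    have s8 : N ≤ (1 - 3 * ε / 8) * ((1 + ε) * N) - ε / 4 * N := by
      have := mul_nonneg (mul_pos hN0 hε).le (sub_nonneg.2 hε1)
      nlinarith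
    have s9 : (n - 1).choose (k - 1) ≤ n.choose (k - 1) := Nat.choose_le_choose _ (Nat.sub_le _ _)
    have s10 : ((n - 1).choose (k - 1) : ℝ) ≤ N := by rw [hN]; exact_mod_cast s9
    have : ((n - 1).choose (k - 1) : ℝ) ≤ ((∑ l ∈ range (m - k * j - 1), b / (l + 1) : ℕ) : ℝ) := by
      linarith
    exact_mod_cast this

theorem breakerWins_of_one {n b : ℕ} (hn : 2 ≤ n) (hb : 1 ≤ b) :
    BreakerWinsMatrixRankGame n 1 b := by
  refine breakerWins_of_box hn le_rfl univ n 0 (by omega) (by simp) ?_ ?_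
  · rw [filter_false_of_mem]
    · simp
    · intro e he
      rw [mem_completeHypergraph] at he
      simp [he]
  · simp only [Nat.sub_self, Nat.choose_zero_right]
    calc 1 ≤ b / (0 + 1) := by simpa
      _ ≤ _ := single_le_sum (f := fun l => b / (l + 1)) (fun _ _ => Nat.zero_le _)
          (mem_range.2 (by omega))

open Filter in
theorem breakerWins_of_large_bias {k : ℕ} (hk : 1 ≤ k) {ε : ℝ} (hε : 0 < ε) :
    ∀ᶠ n : ℕ in atTop, ∀ b : ℕ, (1 + ε) * (n.choose (k - 1) : ℝ) / Real.log n ≤ b →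
      BreakerWinsMatrixRankGame n k b := by
  rcases hk.eq_or_lt with rfl | hk
  · filter_upwards [eventually_ge_atTop 2] with n hn b hb
    refine breakerWins_of_one hn ?_
    have : 0 < Real.log n := Real.log_pos (by exact_mod_cast hn)
    have : (0 : ℝ) < b := lt_of_lt_of_le (by simp; positivity) hb
    exact_mod_cast this
  · filter_upwards [breakerWins_of_large_bias_of_two_le hk (lt_min hε one_pos) (min_le_right ε 1),
      eventually_ge_atTop 2] with n h hn b hb
    refine h b (le_trans ?_ hb)
    have : 0 < Real.log n := Real.log_pos (by exact_mod_cast hn)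
    gcongr
    exact min_le_left _ _

/-! ### Hitting large sets: Beck's potential -/

/-- The potential of a position for the family `(A i)`, `i ∈ I`: each set that the edges of `M` have
not hit counts `2 ^ (a / q)`, where `a` is the number of its elements in `B`. -/
noncomputable def hittingPotential {α ι : Type*} [DecidableEq α] (q : ℝ) (I : Finset ι)
    (A : ι → Finset α) (M B : Finset α) : ℝ :=
  ∑ i ∈ I with Disjoint (A i) M, (2 : ℝ) ^ ((#(A i ∩ B) : ℝ) / q)

/-- Maker never lets the potential grow if she claims a free element whose unhit sets have the greatest
total weight. -/
theorem exists_hittingPotential_le {α ι : Type*} [DecidableEq α] {q : ℝ} (hq : 0 < q)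
    (I : Finset ι) (A : ι → Finset α) (M B free : Finset α) (hfree : free.Nonempty) :
    ∃ e ∈ free, ∀ F ⊆ free, (#F : ℝ) ≤ q →
      hittingPotential q I A (insert e M) (B ∪ F) ≤ hittingPotential q I A M B := by
  classical
  set w : ι → ℝ := fun i => (2 : ℝ) ^ ((#(A i ∩ B) : ℝ) / q) with hw
  have hw0 : ∀ i, 0 ≤ w i := fun i => Real.rpow_nonneg (by norm_num) _
  set U := I.filter (fun i => Disjoint (A i) M) with hU
  obtain ⟨e, he, hmax⟩ := exists_max_image free (fun e => ∑ i ∈ U with e ∈ A i, w i) hfree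
  refine ⟨e, he, fun F hF hFq => ?_⟩
  have hU' : I.filter (fun i => Disjoint (A i) (insert e M)) = U.filter (fun i => e ∉ A i) := by
    ext i
    simp only [hU, mem_filter, disjoint_insert_right]
    tauto
  have hterm : ∀ i, (2 : ℝ) ^ ((#(A i ∩ (B ∪ F)) : ℝ) / q) ≤
      w i + w i * ((∑ f ∈ F, if f ∈ A i then 1 else 0) / q) := by
    intro i
    have hsum : (∑ f ∈ F, if f ∈ A i then (1 : ℝ) else 0) = #(A i ∩ F) := by
      rw [sum_boole, filter_mem_eq_inter, inter_comm]
    have hle : (#(A i ∩ (B ∪ F)) : ℝ) ≤ #(A i ∩ B) + #(A i ∩ F) := by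
      rw [inter_union_distrib_left]
      exact_mod_cast card_union_le _ _
    have hF1 : (#(A i ∩ F) : ℝ) / q ≤ 1 := by
      rw [div_le_one hq]
      exact le_trans (by exact_mod_cast card_le_card inter_subset_right) hFq
    have hbern := rpow_one_add_le_one_add_mul_self (s := 1) (by norm_num)
      (p := (#(A i ∩ F) : ℝ) / q) (by positivity) hF1
    calc (2 : ℝ) ^ ((#(A i ∩ (B ∪ F)) : ℝ) / q)
        ≤ (2 : ℝ) ^ ((#(A i ∩ B) : ℝ) / q + (#(A i ∩ F) : ℝ) / q) := by
          rw [← add_div]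
          exact Real.rpow_le_rpow_of_exponent_le (by norm_num) (by gcongr)
      _ = w i * (1 + 1 : ℝ) ^ ((#(A i ∩ F) : ℝ) / q) := by
          rw [Real.rpow_add (by norm_num)]; norm_num [hw]
      _ ≤ w i * (1 + (#(A i ∩ F) : ℝ) / q * 1) := mul_le_mul_of_nonneg_left hbern (hw0 i)
      _ = _ := by rw [hsum]; ring
  have hswap : ∑ i ∈ U with e ∉ A i, w i * ((∑ f ∈ F, if f ∈ A i then 1 else 0) / q) ≤
      ∑ i ∈ U with e ∈ A i, w i := by
    calc ∑ i ∈ U with e ∉ A i, w i * ((∑ f ∈ F, if f ∈ A i then (1 : ℝ) else 0) / q)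
        ≤ ∑ i ∈ U, w i * ((∑ f ∈ F, if f ∈ A i then (1 : ℝ) else 0) / q) := by
          refine sum_le_sum_of_subset_of_nonneg (filter_subset _ _) fun i _ _ => ?_
          refine mul_nonneg (hw0 i) (div_nonneg (sum_nonneg fun f _ => ?_) hq.le)
          split_ifs <;> norm_num
      _ = (∑ f ∈ F, ∑ i ∈ U with f ∈ A i, w i) / q := by
          simp_rw [sum_filter]
          rw [sum_comm, sum_div]
          refine sum_congr rfl fun i _ => ?_
          rw [mul_div_assoc', mul_sum]
          simp
      _ ≤ (∑ f ∈ F, ∑ i ∈ U with e ∈ A i, w i) / q := by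
          exact div_le_div_of_nonneg_right (sum_le_sum fun f hf => hmax f (hF hf)) hq.le
      _ ≤ (q * ∑ i ∈ U with e ∈ A i, w i) / q := by
          rw [sum_const, nsmul_eq_mul]
          gcongr
      _ = _ := by field_simp
  calc hittingPotential q I A (insert e M) (B ∪ F)
      = ∑ i ∈ U with e ∉ A i, (2 : ℝ) ^ ((#(A i ∩ (B ∪ F)) : ℝ) / q) := by
        rw [hittingPotential, ← hU']
    _ ≤ ∑ i ∈ U with e ∉ A i, (w i + w i * ((∑ f ∈ F, if f ∈ A i then 1 else 0) / q)) :=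
        sum_le_sum fun i _ => hterm i
    _ ≤ (∑ i ∈ U with e ∉ A i, w i) + ∑ i ∈ U with e ∈ A i, w i := by
        rw [sum_add_distrib]; linarith
    _ = hittingPotential q I A M B := by
        rw [add_comm, sum_filter_add_sum_filter_not]; rfl

theorem makerWinsFrom_of_hittingPotential {α ι : Type*} [DecidableEq α] {board : Finset α} {b : ℕ}
    {P : Finset α → Prop} {q T : ℝ} (hq : 0 < q) (hbq : (b : ℝ) ≤ q) (I : Finset ι)
    (A : ι → Finset α) (hA : ∀ i ∈ I, A i ⊆ board) (hT : ∀ i ∈ I, T < (2 : ℝ) ^ ((#(A i) : ℝ) / q))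
    (M B : Finset α) (h : hittingPotential q I A M B ≤ T)
    (hP : ∀ M', M ⊆ M' → M' ⊆ board ∪ M → (∀ i ∈ I, ¬ Disjoint (A i) M') → P M') :
    MakerWinsFrom board b P M B := by
  refine makerWinsFrom_of_invariant
    (fun M' B' => M ⊆ M' ∧ M' ⊆ board ∪ M ∧ hittingPotential q I A M' B' ≤ T) ?_ ?_ M B
    ⟨Subset.rfl, subset_union_right, h⟩
  · rintro M' B' ⟨h1, h2, h3⟩ hfree
    refine hP M' h1 h2 fun i hi hdisj => ?_
    have hsub : A i ⊆ B' := by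
      intro x hx
      have h4 : x ∈ M' ∪ B' := by
        by_contra hcon
        exact notMem_empty x (hfree ▸ mem_sdiff.2 ⟨hA i hi hx, hcon⟩)
      exact (mem_union.1 h4).resolve_left (disjoint_left.1 hdisj hx)
    have h5 : (2 : ℝ) ^ ((#(A i) : ℝ) / q) ≤ hittingPotential q I A M' B' := by
      have := single_le_sum (f := fun i => (2 : ℝ) ^ ((#(A i ∩ B') : ℝ) / q))
        (s := I.filter fun i => Disjoint (A i) M') (fun j _ => Real.rpow_nonneg (by norm_num) _)
        (mem_filter.2 ⟨hi, hdisj⟩)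
      simp only [inter_eq_left.2 hsub] at this
      exact this
    linarith [hT i hi]
  · rintro M' B' ⟨h1, h2, h3⟩ hfree
    obtain ⟨e, he, hF⟩ := exists_hittingPotential_le hq I A M' B' _ hfree
    refine ⟨e, he, fun F hturn => ⟨h1.trans (subset_insert _ _), ?_, (hF F ?_ ?_).trans h3⟩⟩
    · exact insert_subset (mem_union_left _ (mem_sdiff.1 he).1) h2
    · exact hturn.1.trans (sdiff_subset_sdiff Subset.rfl
        (union_subset_union (subset_insert _ _) Subset.rfl))
    · refine le_trans ?_ hbq
      exact_mod_cast hturn.2.le.trans (min_le_left _ _)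

/-! ### Serving the endangered vertices in time -/

/-- The vertices that lie in at least `h` of the edges of `C`. -/
noncomputable def dangerous {n : ℕ} (h : ℝ) (C : Finset (Finset (Fin n))) : Finset (Fin n) :=
  univ.filter fun v => h ≤ (#(C.filter (v ∈ ·)) : ℝ)

/-- The number of edges of `C` whose only dangerous vertex is `v`. An edge counts towards the lone
degree of at most one vertex, so a turn of `b` edges raises the sum of all lone degrees by at most `b`,
and not by `k * b`. -/
noncomputable def loneDegree {n : ℕ} (h : ℝ) (C : Finset (Finset (Fin n))) (v : Fin n) : ℕ :=
  #(C.filter fun e => e ∩ dangerous h C = {v})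

/-- The weight of a vertex `v` that Maker has served `m v` times. A vertex needs two services. A vertex
that is not dangerous yet has the weight that an unserved vertex may have when it becomes dangerous. -/
noncomputable def dangerWeight {n : ℕ} (lam c h : ℝ) (C : Finset (Finset (Fin n))) (m : Fin n → ℕ)
    (v : Fin n) : ℝ :=
  if v ∈ dangerous h C then
    if m v < 2 then Real.exp (lam * loneDegree h C v - c * m v) else 0
  else Real.exp (lam * h)

theorem dangerous_mono {n : ℕ} {h : ℝ} {C C' : Finset (Finset (Fin n))} (hC : C ⊆ C') :
    dangerous h C ⊆ dangerous h C' := by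
  intro v hv
  simp only [dangerous, mem_filter, mem_univ, true_and] at hv ⊢
  exact hv.trans (by exact_mod_cast card_le_card (filter_subset_filter _ hC))

theorem dangerWeight_nonneg {n : ℕ} (lam c h : ℝ) (C : Finset (Finset (Fin n))) (m : Fin n → ℕ)
    (v : Fin n) : 0 ≤ dangerWeight lam c h C m v := by
  unfold dangerWeight
  split_ifs <;> positivity

theorem dangerWeight_growth {n : ℕ} {lam c h : ℝ} (hlam : 0 ≤ lam) (hc : 0 ≤ c)
    {C C' : Finset (Finset (Fin n))} (hC : C ⊆ C') (m : Fin n → ℕ) {v : Fin n}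
    (hv : v ∈ dangerous h C') :
    dangerWeight lam c h C' m v ≤ dangerWeight lam c h C m v + dangerWeight lam c h C' m v *
      (lam * #((C' \ C).filter fun e => e ∩ dangerous h C' = {v})) := by
  set δ := #((C' \ C).filter fun e => e ∩ dangerous h C' = {v}) with hδ
  by_cases hm : m v < 2
  swap
  · have : dangerWeight lam c h C' m v = 0 := by simp [dangerWeight, hv, hm]
    rw [this, zero_mul, add_zero]
    exact dangerWeight_nonneg ..
  have hsplit : loneDegree h C' v ≤ #(C.filter fun e => e ∩ dangerous h C' = {v}) + δ := by
    rw [loneDegree, hδ, ← card_union_of_disjoint (disjoint_filter_filter disjoint_sdiff),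
      ← filter_union, union_sdiff_of_subset hC]
  have hsplit' : (loneDegree h C' v : ℝ) ≤
      (#(C.filter fun e => e ∩ dangerous h C' = {v}) : ℝ) + δ := by exact_mod_cast hsplit
  have hold : Real.exp (lam * #(C.filter fun e => e ∩ dangerous h C' = {v}) - c * m v) ≤
      dangerWeight lam c h C m v := by
    have hmem : ∀ e : Finset (Fin n), e ∩ dangerous h C' = {v} → v ∈ e := fun e he =>
      (mem_inter.1 (he ▸ mem_singleton_self v)).1
    by_cases hvC : v ∈ dangerous h C
    · simp only [dangerWeight, hvC, hm, if_true, Real.exp_le_exp]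
      gcongr
      refine card_le_card fun e he => ?_
      rw [mem_filter] at he ⊢
      refine ⟨he.1, subset_antisymm ?_ (singleton_subset_iff.2 (mem_inter.2 ⟨hmem e he.2, hvC⟩))⟩
      rw [← he.2]
      exact inter_subset_inter_left (dangerous_mono hC)
    · simp only [dangerWeight, hvC, if_false, Real.exp_le_exp]
      have h1 : (#(C.filter fun e => e ∩ dangerous h C' = {v}) : ℝ) ≤ #(C.filter (v ∈ ·)) := by
        exact_mod_cast card_le_card (monotone_filter_right C fun e _ he => hmem e he)
      have h2 : (#(C.filter (v ∈ ·)) : ℝ) < h := by simpa [dangerous] using hvC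
      have h3 : lam * #(C.filter fun e => e ∩ dangerous h C' = {v}) ≤ lam * h := by
        gcongr; linarith
      have h4 : 0 ≤ c * m v := by positivity
      linarith
  have hnew : dangerWeight lam c h C' m v ≤
      dangerWeight lam c h C m v * Real.exp (lam * δ) := by
    calc dangerWeight lam c h C' m v = Real.exp (lam * loneDegree h C' v - c * m v) := by
          simp [dangerWeight, hv, hm]
      _ ≤ Real.exp ((lam * #(C.filter fun e => e ∩ dangerous h C' = {v}) - c * m v) + lam * δ) := by
          rw [Real.exp_le_exp]
          have := mul_le_mul_of_nonneg_left hsplit' hlam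
          linarith
      _ ≤ _ := by rw [Real.exp_add]; gcongr
  have hexp : 1 - lam * δ ≤ Real.exp (-(lam * δ)) := by
    have := Real.add_one_le_exp (-(lam * (δ : ℝ))); linarith
  have h5 : dangerWeight lam c h C' m v * Real.exp (-(lam * δ)) ≤ dangerWeight lam c h C m v := by
    rw [Real.exp_neg, ← div_eq_mul_inv, div_le_iff₀ (Real.exp_pos _)]
    exact hnew
  have h6 := mul_le_mul_of_nonneg_left hexp (dangerWeight_nonneg lam c h C' m v)
  linarith

/-- After any at most `q` further edges, Maker can serve a vertex in need such that the total weight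
does not exceed what it was before: she serves a dangerous vertex `v` of the greatest weight `W`. The new
edges have increased the total by at most `lam * q * W`, and the service removes `(1 - exp (-c)) * W`. -/
theorem exists_sum_dangerWeight_le {n : ℕ} {lam c h q : ℝ} (hlam : 0 ≤ lam) (hc : 0 ≤ c)
    (hq : lam * q ≤ 1 - Real.exp (-c)) {C C' : Finset (Finset (Fin n))} (hC : C ⊆ C')
    (hCq : (#(C' \ C) : ℝ) ≤ q) (m : Fin n → ℕ) (hm : ∃ v, m v < 2) :
    ∃ v, m v < 2 ∧ ∑ u, dangerWeight lam c h C' (Function.update m v (m v + 1)) u ≤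
      ∑ u, dangerWeight lam c h C m u := by
  set δ : Fin n → ℕ := fun v => #((C' \ C).filter fun e => e ∩ dangerous h C' = {v}) with hδ
  have hδsum : ∑ v ∈ dangerous h C', (δ v : ℝ) ≤ q := by
    refine le_trans ?_ hCq
    rw [← Nat.cast_sum, hδ]
    rw [← card_biUnion]
    · exact_mod_cast card_le_card (biUnion_subset.2 fun v _ => filter_subset _ _)
    · intro u _ v _ huv
      refine disjoint_filter.2 fun e _ h1 h2 => huv ?_
      exact singleton_injective (h1.symm.trans h2)
  -- The total growth, in terms of a bound on the weights of the dangerous vertices.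
  have hgrow : ∀ W, 0 ≤ W → (∀ v ∈ dangerous h C', dangerWeight lam c h C' m v ≤ W) →
      ∑ u, dangerWeight lam c h C' m u ≤ ∑ u, dangerWeight lam c h C m u + lam * q * W := by
    intro W hW0 hW
    have h1 : ∀ u, dangerWeight lam c h C' m u ≤ dangerWeight lam c h C m u +
        if u ∈ dangerous h C' then lam * W * δ u else 0 := by
      intro u
      split_ifs with hu
      · refine (dangerWeight_growth hlam hc hC m hu).trans ?_
        have : dangerWeight lam c h C' m u * (lam * δ u) ≤ W * (lam * δ u) :=
          mul_le_mul_of_nonneg_right (hW u hu) (by positivity)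
        linarith
      · have hu' : u ∉ dangerous h C := fun hcon => hu (dangerous_mono hC hcon)
        simp [dangerWeight, hu, hu']
    refine (sum_le_sum fun u _ => h1 u).trans ?_
    rw [sum_add_distrib, ← sum_filter, filter_mem_eq_inter, univ_inter, ← mul_sum]
    have : lam * W * ∑ v ∈ dangerous h C', (δ v : ℝ) ≤ lam * W * q := by gcongr
    linarith
  have hserve : ∀ v u, u ≠ v → dangerWeight lam c h C' (Function.update m v (m v + 1)) u =
      dangerWeight lam c h C' m u := by
    intro v u huv
    simp [dangerWeight, Function.update_of_ne huv]
  rcases ((dangerous h C').filter fun v => m v < 2).eq_empty_or_nonempty with h0 | h0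
  · obtain ⟨v, hv⟩ := hm
    have hnot : ∀ u ∈ dangerous h C', ¬ m u < 2 := fun u hu hmu =>
      notMem_empty u (h0 ▸ mem_filter.2 ⟨hu, hmu⟩)
    refine ⟨v, hv, ?_⟩
    have h1 := hgrow 0 le_rfl fun u hu => by simp [dangerWeight, hu, hnot u hu]
    rw [mul_zero, add_zero] at h1
    refine le_trans (le_of_eq (sum_congr rfl fun u _ => ?_)) h1
    by_cases huv : u = v
    · subst huv
      have hu : u ∉ dangerous h C' := fun hcon => hnot u hcon hv
      simp [dangerWeight, hu]
    · exact hserve v u huv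
  · obtain ⟨v, hv, hmax⟩ := exists_max_image _ (dangerWeight lam c h C' m) h0
    rw [mem_filter] at hv
    refine ⟨v, hv.2, ?_⟩
    set W := dangerWeight lam c h C' m v with hW
    have hW0 : 0 ≤ W := dangerWeight_nonneg ..
    have h1 := hgrow W hW0 fun u hu => by
      by_cases hmu : m u < 2
      · exact hmax u (mem_filter.2 ⟨hu, hmu⟩)
      · simp [dangerWeight, hu, hmu, hW0]
    have h2 : dangerWeight lam c h C' (Function.update m v (m v + 1)) v ≤ Real.exp (-c) * W := by
      have hWeq : W = Real.exp (lam * loneDegree h C' v - c * m v) := by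
        simp [hW, dangerWeight, hv.1, hv.2]
      by_cases hm2 : m v + 1 < 2
      · rw [hWeq, ← Real.exp_add]
        simp only [dangerWeight, hv.1, Function.update_self, hm2, if_true]
        rw [Real.exp_le_exp]
        push_cast
        linarith
      · simp only [dangerWeight, hv.1, Function.update_self, hm2, if_true, if_false]
        positivity
    have h3 : ∑ u, dangerWeight lam c h C' (Function.update m v (m v + 1)) u ≤
        ∑ u, dangerWeight lam c h C' m u - (1 - Real.exp (-c)) * W := by
      rw [← add_sum_erase _ _ (mem_univ v), ← add_sum_erase (a := v) univ
        (dangerWeight lam c h C' m) (mem_univ v),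
        sum_congr rfl fun u hu => hserve v u (ne_of_mem_erase hu)]
      linarith
    have h4 := mul_le_mul_of_nonneg_right hq hW0
    linarith

theorem card_dangerous_mul_le {n k : ℕ} (h : ℝ) {C : Finset (Finset (Fin n))}
    (hC : C ⊆ completeHypergraph n k) : #(dangerous h C) * h ≤ k * #C := by
  calc #(dangerous h C) * h = ∑ v ∈ dangerous h C, h := by rw [sum_const, nsmul_eq_mul]
    _ ≤ ∑ v ∈ dangerous h C, (#(C.filter (v ∈ ·)) : ℝ) :=
        sum_le_sum fun v hv => (mem_filter.1 hv).2
    _ ≤ ∑ v, (#(C.filter (v ∈ ·)) : ℝ) :=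
        sum_le_sum_of_subset_of_nonneg (subset_univ _) fun _ _ _ => by positivity
    _ = ((∑ e ∈ C, #e : ℕ) : ℝ) := by
        rw [← Nat.cast_sum]
        congr 1
        have := sum_card_bipartiteAbove_eq_sum_card_bipartiteBelow
          (s := (univ : Finset (Fin n))) (t := C) (fun v e => v ∈ e)
        simpa [bipartiteAbove, bipartiteBelow] using this
    _ = k * #C := by
        rw [sum_congr rfl fun e he => mem_completeHypergraph.1 (hC he)]
        simp [mul_comm]

theorem card_filter_mem_le_loneDegree_add {n k : ℕ} (hk : 2 ≤ k) (h : ℝ)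
    {C : Finset (Finset (Fin n))} (hC : C ⊆ completeHypergraph n k) {v : Fin n}
    (hv : v ∈ dangerous h C) :
    #(C.filter (v ∈ ·)) ≤ loneDegree h C v + #(dangerous h C) * (n - 2).choose (k - 2) := by
  refine le_trans ?_ (Nat.add_le_add_left (card_edges_through_meeting hk v (dangerous h C)) _)
  refine le_trans (card_le_card fun e he => ?_) (card_union_le _ _)
  rw [mem_filter] at he
  by_cases hex : ∃ u ∈ dangerous h C, u ≠ v ∧ u ∈ e
  · exact mem_union_right _ (mem_filter.2 ⟨hC he.1, he.2, hex⟩)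
  · refine mem_union_left _ (mem_filter.2 ⟨he.1, ?_⟩)
    push Not at hex
    ext u
    rw [mem_inter, mem_singleton]
    exact ⟨fun hu => by_contra fun hne => hex u hu.2 hne hu.1, by rintro rfl; exact ⟨he.2, hv⟩⟩

/-- A bound for the degree of a vertex that still needs service. -/
theorem card_filter_mem_le_of_sum_dangerWeight_le {n k : ℕ} (hk : 2 ≤ k) {lam c h : ℝ}
    (hlam : 0 < lam) (hc : 0 ≤ c) {C : Finset (Finset (Fin n))}
    (hC : C ⊆ completeHypergraph n k) {m : Fin n → ℕ} {v : Fin n} (hm : m v < 2)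
    (hsum : ∑ u, dangerWeight lam c h C m u ≤ n * Real.exp (lam * h)) :
    (#(C.filter (v ∈ ·)) : ℝ) ≤ h + (Real.log n + 2 * c) / lam +
      #(dangerous h C) * (n - 2).choose (k - 2) := by
  have hn : (1 : ℝ) ≤ n := by exact_mod_cast v.pos
  have hlog : 0 ≤ Real.log n := Real.log_nonneg hn
  by_cases hv : v ∈ dangerous h C
  · have h1 : (#(C.filter (v ∈ ·)) : ℝ) ≤ loneDegree h C v +
        #(dangerous h C) * (n - 2).choose (k - 2) := by
      exact_mod_cast card_filter_mem_le_loneDegree_add hk h hC hv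
    have h2 : Real.exp (lam * loneDegree h C v - c * m v) ≤ Real.exp (Real.log n + lam * h) := by
      rw [Real.exp_add, Real.exp_log (by linarith)]
      refine le_trans ?_ hsum
      have := single_le_sum (fun u _ => dangerWeight_nonneg lam c h C m u) (mem_univ v)
      refine le_trans (le_of_eq ?_) this
      simp [dangerWeight, hv, hm]
    rw [Real.exp_le_exp] at h2
    have h3 : c * m v ≤ c * 2 := by
      gcongr; exact_mod_cast hm.le
    have h4 : (loneDegree h C v : ℝ) - h ≤ (Real.log n + 2 * c) / lam := by
      rw [le_div_iff₀ hlam]; linarith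
    linarith
  · have h1 : (#(C.filter (v ∈ ·)) : ℝ) < h := by simpa [dangerous] using hv
    have h2 : 0 ≤ (Real.log n + 2 * c) / lam := by positivity
    have h3 : (0 : ℝ) ≤ #(dangerous h C) * (n - 2).choose (k - 2) := by positivity
    linarith

/-! ### Choosing edges that expand -/

/-- A bound for the probability that `S` does not expand, that is, that no `v ∈ S` owns an edge which meets
`S` in `v` only, if every vertex is going to own two edges, of which the ones in `own` are chosen already
and each of the others fails with probability at most `p S`. -/
noncomputable def failureWeight {n : ℕ} (p : Finset (Fin n) → ℝ)
    (own : Fin n → Finset (Finset (Fin n))) (S : Finset (Fin n)) : ℝ :=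
  if ∀ v ∈ S, ∀ e ∈ own v, e ∩ S ≠ {v} then ∏ v ∈ S, p S ^ (2 - #(own v)) else 0

theorem failureWeight_nonneg {n : ℕ} {p : Finset (Fin n) → ℝ} (hp : ∀ S, 0 ≤ p S)
    (own : Fin n → Finset (Finset (Fin n))) (S : Finset (Fin n)) : 0 ≤ failureWeight p own S := by
  unfold failureWeight
  split_ifs
  · exact prod_nonneg fun v _ => pow_nonneg (hp S) _
  · exact le_rfl

theorem failureWeight_insert_le {n : ℕ} {p : Finset (Fin n) → ℝ} {S : Finset (Fin n)} (hp : 0 < p S)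
    (own : Fin n → Finset (Finset (Fin n))) {v : Fin n} (hv : #(own v) < 2) (hvS : v ∈ S)
    {e : Finset (Fin n)} (he : e ∉ own v) :
    failureWeight p (Function.update own v (insert e (own v))) S ≤
      if e ∩ S ≠ {v} then failureWeight p own S / p S else 0 := by
  unfold failureWeight
  by_cases h1 : ∀ u ∈ S, ∀ f ∈ Function.update own v (insert e (own v)) u, f ∩ S ≠ {u}
  · have h2 : e ∩ S ≠ {v} := h1 v hvS e (by simp)
    have h3 : ∀ u ∈ S, ∀ f ∈ own u, f ∩ S ≠ {u} := by
      intro u hu f hf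
      refine h1 u hu f ?_
      by_cases huv : u = v
      · subst huv; simp [hf]
      · simpa [Function.update_of_ne huv] using hf
    rw [if_pos h1, if_pos h2, if_pos h3, le_div_iff₀ hp, ← mul_prod_erase _ _ hvS,
      ← mul_prod_erase S (fun u => p S ^ (2 - #(own u))) hvS]
    have h4 : ∏ u ∈ S.erase v, p S ^ (2 - #(Function.update own v (insert e (own v)) u)) =
        ∏ u ∈ S.erase v, p S ^ (2 - #(own u)) :=
      prod_congr rfl fun u hu => by rw [Function.update_of_ne (ne_of_mem_erase hu)]
    rw [h4, Function.update_self, card_insert_of_notMem he,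
      show 2 - #(own v) = (2 - (#(own v) + 1)) + 1 by omega, pow_succ]
    exact le_of_eq (by ring)
  · rw [if_neg h1]
    split_ifs
    · exact div_nonneg (prod_nonneg fun v _ => pow_nonneg hp.le _) hp.le
    · simp
    · exact le_rfl

/-- The method of conditional expectations: some candidate does not increase the expected number of
sets that fail to expand, because the candidates do not do so on average. -/
theorem exists_sum_failureWeight_le {n : ℕ} {p : Finset (Fin n) → ℝ} (Fam : Finset (Finset (Fin n)))
    (hp : ∀ S ∈ Fam, 0 < p S) (own : Fin n → Finset (Finset (Fin n))) {v : Fin n}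
    (hv : #(own v) < 2) (Fr : Finset (Finset (Fin n))) (hFr : Fr.Nonempty)
    (hown : ∀ e ∈ Fr, e ∉ own v)
    (hbad : ∀ S ∈ Fam, v ∈ S → (#(Fr.filter fun e => e ∩ S ≠ {v}) : ℝ) ≤ p S * #Fr) :
    ∃ e ∈ Fr, ∑ S ∈ Fam, failureWeight p (Function.update own v (insert e (own v))) S ≤
      ∑ S ∈ Fam, failureWeight p own S := by
  refine exists_le_of_sum_le hFr ?_
  rw [sum_comm, sum_const, smul_sum]
  refine sum_le_sum fun S hS => ?_
  rw [nsmul_eq_mul]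
  by_cases hvS : v ∈ S
  · have hnn : 0 ≤ failureWeight p own S / p S := by
      refine div_nonneg ?_ (hp S hS).le
      unfold failureWeight
      split_ifs
      · exact prod_nonneg fun v _ => pow_nonneg (hp S hS).le _
      · exact le_rfl
    calc ∑ e ∈ Fr, failureWeight p (Function.update own v (insert e (own v))) S
        ≤ ∑ e ∈ Fr, if e ∩ S ≠ {v} then failureWeight p own S / p S else 0 :=
          sum_le_sum fun e he => failureWeight_insert_le (hp S hS) own hv hvS (hown e he)
      _ = #(Fr.filter fun e => e ∩ S ≠ {v}) * (failureWeight p own S / p S) := by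
          rw [← sum_filter, sum_const, nsmul_eq_mul]
      _ ≤ p S * #Fr * (failureWeight p own S / p S) :=
          mul_le_mul_of_nonneg_right (hbad S hS hvS) hnn
      _ = _ := by field_simp [(hp S hS).ne']
  · have : ∀ e ∈ Fr, failureWeight p (Function.update own v (insert e (own v))) S =
        failureWeight p own S := by
      intro e _
      have hu : ∀ u ∈ S, Function.update own v (insert e (own v)) u = own u := fun u hu =>
        Function.update_of_ne (by rintro rfl; exact hvS hu) _ _
      unfold failureWeight
      rw [prod_congr rfl fun u hu' => by rw [hu u hu']]
      congr 1
      simp only [eq_iff_iff]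
      exact forall₂_congr fun u hu' => by rw [hu u hu']
    rw [sum_congr rfl this, sum_const, nsmul_eq_mul]

/-- Once all vertices own two edges, the weights count the sets that fail to expand. -/
theorem exists_inter_eq_singleton_of_sum_failureWeight_lt {n : ℕ} {p : Finset (Fin n) → ℝ}
    (hp : ∀ S, 0 ≤ p S) (Fam : Finset (Finset (Fin n))) (own : Fin n → Finset (Finset (Fin n)))
    (hown : ∀ v, 2 ≤ #(own v)) (hsum : ∑ S ∈ Fam, failureWeight p own S < 1)
    {S : Finset (Fin n)} (hS : S ∈ Fam) : ∃ v ∈ S, ∃ e ∈ own v, e ∩ S = {v} := by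
  by_contra! hcon
  have h1 : failureWeight p own S = 1 := by
    unfold failureWeight
    rw [if_pos hcon]
    exact prod_eq_one fun v _ => by rw [Nat.sub_eq_zero_of_le (hown v), pow_zero]
  have h2 := single_le_sum (fun T _ => failureWeight_nonneg hp own T) hS
  linarith

/-! ### Maker's strategy -/

/-- A position after a move of Maker in which all sets of at most `t` vertices can still be made to
expand. `C` is the set of all claimed edges but for Maker's last one, `own v` the set of the edges with
which Maker has served `v`, and `p S` is a bound for the probability with which a random free edge at a
vertex of `S` meets `S` a second time. -/
structure IsServicePosition (n k b t : ℕ) (lam c h : ℝ) (p : Finset (Fin n) → ℝ)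
    (M B C : Finset (Finset (Fin n))) (own : Fin n → Finset (Finset (Fin n))) : Prop where
  maker_subset : M ⊆ completeHypergraph n k
  breaker_subset : B ⊆ completeHypergraph n k
  subset_claimed : C ⊆ M ∪ B
  card_claimed_sdiff : #((M ∪ B) \ C) ≤ 1
  own_subset : ∀ v, own v ⊆ M
  card_own_le : ∀ v, #(own v) ≤ 2
  card_maker : #M = ∑ v, #(own v)
  card_breaker : #B ≤ b * #M
  danger : ∑ v, dangerWeight lam c h C (fun v => #(own v)) v ≤ n * Real.exp (lam * h)
  failure : ∑ S with S.Nonempty ∧ #S ≤ t, failureWeight p own S < 1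

theorem IsServicePosition.card_maker_le {n k b t : ℕ} {lam c h : ℝ} {p : Finset (Fin n) → ℝ}
    {M B C : Finset (Finset (Fin n))} {own : Fin n → Finset (Finset (Fin n))}
    (hpos : IsServicePosition n k b t lam c h p M B C own) : #M ≤ 2 * n := by
  rw [hpos.card_maker]
  refine (sum_le_card_nsmul _ _ 2 fun v _ => hpos.card_own_le v).trans ?_
  simp [mul_comm]

/-- The vertex that Maker serves next still has `δ` free edges. -/
theorem IsServicePosition.exists_vertex {n k b t : ℕ} (hk : 2 ≤ k) {lam c h δ : ℝ}
    (hlam : 0 < lam) (hc : 0 ≤ c) (hh : 0 < h)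
    (hlamb : lam * (b + 1) ≤ 1 - Real.exp (-c))
    (hdeg : h + (Real.log n + 2 * c) / lam + k * ((2 * n + 1) * (b + 1)) / h *
      (n - 2).choose (k - 2) + (b + 1) + δ ≤ (n - 1).choose (k - 1))
    {p : Finset (Fin n) → ℝ} {M B C : Finset (Finset (Fin n))} {own : Fin n → Finset (Finset (Fin n))}
    (hpos : IsServicePosition n k b t lam c h p M B C own)
    (hserve : ∃ v, #(own v) < 2) {F : Finset (Finset (Fin n))}
    (hF : F ⊆ freeEdges (completeHypergraph n k) M B) (hFb : #F ≤ b) :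
    ∃ v, #(own v) < 2 ∧
      ∑ u, dangerWeight lam c h (M ∪ (B ∪ F)) (Function.update (fun u => #(own u)) v (#(own v) + 1)) u
        ≤ ∑ u, dangerWeight lam c h C (fun u => #(own u)) u ∧
      δ ≤ #((freeEdges (completeHypergraph n k) M (B ∪ F)).filter (v ∈ ·)) := by
  set C' := M ∪ (B ∪ F) with hC'
  have hFboard : F ⊆ completeHypergraph n k := hF.trans sdiff_subset
  have hBF : B ∪ F ⊆ completeHypergraph n k := union_subset hpos.breaker_subset hFboard
  have hC'board : C' ⊆ completeHypergraph n k := union_subset hpos.maker_subset hBF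
  have hCC' : C ⊆ C' := hpos.subset_claimed.trans
    (union_subset_union Subset.rfl subset_union_left)
  have hdiff : #(C' \ C) ≤ b + 1 := by
    have : C' \ C ⊆ F ∪ ((M ∪ B) \ C) := by
      intro x hx
      simp only [hC', mem_sdiff, mem_union] at hx ⊢
      tauto
    refine (card_le_card this).trans ((card_union_le _ _).trans ?_)
    have := hpos.card_claimed_sdiff
    omega
  obtain ⟨v, hv, hsum⟩ := exists_sum_dangerWeight_le hlam.le hc hlamb hCC'
    (by exact_mod_cast hdiff) (fun v => #(own v)) hserve
  have hdegC : (#(C.filter (v ∈ ·)) : ℝ) ≤ h + (Real.log n + 2 * c) / lam +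
      k * ((2 * n + 1) * (b + 1)) / h * (n - 2).choose (k - 2) := by
    refine (card_filter_mem_le_of_sum_dangerWeight_le hk hlam hc (hCC'.trans hC'board) hv
      hpos.danger).trans ?_
    have hCcard : #C ≤ (2 * n + 1) * (b + 1) := by
      calc #C ≤ #M + #B := (card_le_card hpos.subset_claimed).trans (card_union_le _ _)
        _ ≤ #M + b * #M := Nat.add_le_add_left hpos.card_breaker _
        _ = #M * (b + 1) := by ring
        _ ≤ _ := Nat.mul_le_mul_right _ (hpos.card_maker_le.trans (Nat.le_succ _))
    have hdang : (#(dangerous h C) : ℝ) ≤ k * ((2 * n + 1) * (b + 1)) / h := by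
      rw [le_div_iff₀ hh]
      refine (card_dangerous_mul_le h (hCC'.trans hC'board)).trans ?_
      gcongr
      exact_mod_cast hCcard
    gcongr
  have hdegC' : #(C'.filter (v ∈ ·)) ≤ #(C.filter (v ∈ ·)) + (b + 1) := by
    have : C'.filter (v ∈ ·) ⊆ C.filter (v ∈ ·) ∪ (C' \ C) := by
      intro x hx
      simp only [mem_filter, mem_union, mem_sdiff] at hx ⊢
      tauto
    exact (card_le_card this).trans ((card_union_le _ _).trans (Nat.add_le_add_left hdiff _))
  refine ⟨v, hv, hsum, ?_⟩
  set Fr := (freeEdges (completeHypergraph n k) M (B ∪ F)).filter (v ∈ ·) with hFr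
  have h1 : (n - 1).choose (k - 1) ≤ #Fr + #(C'.filter (v ∈ ·)) := by
    rw [← card_edges_through (by omega) v]
    refine (card_le_card fun e he => ?_).trans (card_union_le _ _)
    simp only [hFr, hC', freeEdges, mem_filter, mem_union, mem_sdiff] at he ⊢
    tauto
  have h2 : ((n - 1).choose (k - 1) : ℝ) ≤ #Fr + #(C'.filter (v ∈ ·)) := by exact_mod_cast h1
  have h3 : (#(C'.filter (v ∈ ·)) : ℝ) ≤ #(C.filter (v ∈ ·)) + (b + 1) := by
    exact_mod_cast hdegC'
  linarith

/-- The round in which Maker serves one more vertex: one of the free edges at the vertex keeps the failure weight below `1`. -/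
theorem IsServicePosition.exists_move {n k b t : ℕ} (hk : 2 ≤ k) {lam c h δ : ℝ}
    (hlam : 0 < lam) (hc : 0 ≤ c) (hh : 0 < h) (hδ : 0 < δ)
    (hlamb : lam * (b + 1) ≤ 1 - Real.exp (-c))
    (hdeg : h + (Real.log n + 2 * c) / lam + k * ((2 * n + 1) * (b + 1)) / h *
      (n - 2).choose (k - 2) + (b + 1) + δ ≤ (n - 1).choose (k - 1))
    {M B C : Finset (Finset (Fin n))} {own : Fin n → Finset (Finset (Fin n))}
    (hpos : IsServicePosition n k b t lam c h
      (fun S => #S * (n - 2).choose (k - 2) / δ) M B C own)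
    (hserve : ∃ v, #(own v) < 2) {F : Finset (Finset (Fin n))}
    (hF : F ⊆ freeEdges (completeHypergraph n k) M B) (hFb : #F ≤ b) :
    ∃ e ∈ freeEdges (completeHypergraph n k) M (B ∪ F), ∃ own',
      IsServicePosition n k b t lam c h (fun S => #S * (n - 2).choose (k - 2) / δ)
        (insert e M) (B ∪ F) (M ∪ (B ∪ F)) own' := by
  set C' := M ∪ (B ∪ F) with hC'
  obtain ⟨v, hv, hsum, hFrcard⟩ := hpos.exists_vertex hk hlam hc hh hlamb hdeg hserve hF hFb
  set Fr := (freeEdges (completeHypergraph n k) M (B ∪ F)).filter (v ∈ ·) with hFr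
  have hBF : B ∪ F ⊆ completeHypergraph n k :=
    union_subset hpos.breaker_subset (hF.trans sdiff_subset)
  have hFr0 : (0 : ℝ) < #Fr := hδ.trans_le hFrcard
  have hkn : k ≤ n := by
    obtain ⟨e, he⟩ := card_pos.1 (by exact_mod_cast hFr0 : 0 < #Fr)
    have h1 := mem_completeHypergraph.1 (mem_sdiff.1 (mem_filter.1 he).1).1
    have h2 := card_le_univ e
    rw [Fintype.card_fin] at h2
    omega
  have hκ : (0 : ℝ) < (n - 2).choose (k - 2) := by
    exact_mod_cast Nat.choose_pos (by omega : k - 2 ≤ n - 2)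
  have hnotM : ∀ e ∈ Fr, e ∉ M := fun e he h =>
    (mem_sdiff.1 (mem_filter.1 he).1).2 (mem_union_left _ h)
  obtain ⟨e, he, hfail⟩ := exists_sum_failureWeight_le
    (p := fun S : Finset (Fin n) => (#S * (n - 2).choose (k - 2) / δ : ℝ))
    (univ.filter fun S : Finset (Fin n) => S.Nonempty ∧ #S ≤ t)
    (fun S hS => by
      have : 0 < #S := (mem_filter.1 hS).2.1.card_pos
      positivity)
    own hv Fr (card_pos.1 (by exact_mod_cast hFr0))
    (fun e he h => hnotM e he (hpos.own_subset v h))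
    (fun S _ hvS => by
      have h1 : #(Fr.filter fun e => e ∩ S ≠ {v}) ≤ #S * (n - 2).choose (k - 2) := by
        refine (card_le_card fun e he => ?_).trans (card_edges_through_meeting hk v S)
        rw [mem_filter] at he
        obtain ⟨⟨he1, he2⟩, he3⟩ := And.intro (mem_filter.1 he.1) he.2
        refine mem_filter.2 ⟨(mem_sdiff.1 he1).1, he2, ?_⟩
        by_contra! hcon
        refine he3 ?_
        ext u
        rw [mem_inter, mem_singleton]
        exact ⟨fun hu => by_contra fun hne => hcon u hu.2 hne hu.1,
          by rintro rfl; exact ⟨he2, hvS⟩⟩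
      calc (#(Fr.filter fun e => e ∩ S ≠ {v}) : ℝ) ≤ #S * (n - 2).choose (k - 2) := by
            exact_mod_cast h1
        _ = #S * (n - 2).choose (k - 2) / δ * δ := by field_simp
        _ ≤ #S * (n - 2).choose (k - 2) / δ * #Fr := by gcongr)
  have heM := hnotM e he
  have hef := (mem_filter.1 he).1
  have heown : e ∉ own v := fun h => heM (hpos.own_subset v h)
  have hcardown : (fun u => #(Function.update own v (insert e (own v)) u)) =
      Function.update (fun u => #(own u)) v (#(own v) + 1) := by
    funext u
    by_cases huv : u = v
    · subst huv; simp [card_insert_of_notMem heown]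
    · simp [Function.update_of_ne huv]
  refine ⟨e, hef, Function.update own v (insert e (own v)), ?_⟩
  constructor
  · exact insert_subset (mem_sdiff.1 hef).1 hpos.maker_subset
  · exact hBF
  · exact union_subset_union (subset_insert _ _) Subset.rfl
  · refine (card_le_card (t := {e}) fun x hx => ?_).trans (by simp)
    simp only [hC', mem_sdiff, mem_union, mem_insert, mem_singleton] at hx ⊢
    tauto
  · intro u
    by_cases huv : u = v
    · subst huv
      rw [Function.update_self]
      exact insert_subset_insert _ (hpos.own_subset u)
    · rw [Function.update_of_ne huv]
      exact (hpos.own_subset u).trans (subset_insert _ _)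
  · intro u
    rw [congrFun hcardown u]
    by_cases huv : u = v
    · subst huv; simpa using hv
    · rw [Function.update_of_ne huv]; exact hpos.card_own_le u
  · rw [card_insert_of_notMem heM, hpos.card_maker, hcardown,
      sum_update_of_mem (mem_univ v), ← add_sum_erase _ _ (mem_univ v), sdiff_singleton_eq_erase]
    ring
  · rw [card_insert_of_notMem heM]
    refine (card_union_le _ _).trans ?_
    have := hpos.card_breaker
    rw [Nat.mul_succ]
    omega
  · rw [hcardown]
    exact hsum.trans hpos.danger
  · exact hfail.trans_lt hpos.failure

/-- When all vertices have been served, small sets are hit, and the potential of the family of large sets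
is small compared with the number of edges that meet a large set in an odd number of vertices. -/
theorem IsServicePosition.makerWinsFrom {n k b t : ℕ} (hn : 1 ≤ n) {lam c h q : ℝ}
    {p : Finset (Fin n) → ℝ} (hp : ∀ S, 0 ≤ p S) (hq : 0 < q) (hbq : (b : ℝ) ≤ q)
    (hlarge : ∀ S : Finset (Fin n), t < #S → (Odd k ∨ t < #Sᶜ) →
      q * (3 * n + 1) < #((completeHypergraph n k).filter fun e => Odd #(e ∩ S)))
    {M B C : Finset (Finset (Fin n))} {own : Fin n → Finset (Finset (Fin n))}
    (hpos : IsServicePosition n k b t lam c h p M B C own)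
    (hserve : ∀ v, 2 ≤ #(own v)) {F : Finset (Finset (Fin n))} (hFb : #F ≤ b) :
    MakerWinsFrom (completeHypergraph n k) b (HasFullRank n k) M (B ∪ F) := by
  classical
  refine makerWinsFrom_of_hittingPotential (T := (2 : ℝ) ^ (3 * n + 1 : ℝ)) hq hbq
    (univ.filter fun S : Finset (Fin n) => t < #S ∧ (Odd k ∨ t < #Sᶜ))
    (fun S => (completeHypergraph n k).filter fun e => Odd #(e ∩ S))
    (fun S _ => filter_subset _ _) (fun S hS => ?_) M (B ∪ F) ?_ ?_
  · obtain ⟨h1, h2⟩ := (mem_filter.1 hS).2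
    refine Real.rpow_lt_rpow_of_exponent_lt (by norm_num) ?_
    rw [lt_div_iff₀ hq, mul_comm]
    exact hlarge S h1 h2
  · have hBcard : (#(B ∪ F) : ℝ) ≤ q * (2 * n + 1) := by
      have h1 : #(B ∪ F) ≤ b * (2 * n + 1) := by
        refine (card_union_le _ _).trans ?_
        have h2 := hpos.card_breaker.trans (Nat.mul_le_mul_left b hpos.card_maker_le)
        rw [Nat.mul_succ]
        omega
      calc (#(B ∪ F) : ℝ) ≤ b * (2 * n + 1) := by exact_mod_cast h1
        _ ≤ q * (2 * n + 1) := by gcongr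
    calc hittingPotential q _ _ M (B ∪ F)
        ≤ ∑ S : Finset (Fin n), (2 : ℝ) ^ (2 * n + 1 : ℝ) := by
          unfold hittingPotential
          refine (sum_le_sum_of_subset_of_nonneg (subset_univ _)
            fun _ _ _ => Real.rpow_nonneg (by norm_num) _).trans (sum_le_sum fun S _ => ?_)
          refine Real.rpow_le_rpow_of_exponent_le (by norm_num) ?_
          rw [div_le_iff₀ hq, mul_comm]
          exact le_trans (by exact_mod_cast card_le_card inter_subset_right) hBcard
      _ = (2 : ℝ) ^ (3 * n + 1 : ℝ) := by
          rw [sum_const, card_univ, Fintype.card_finset, Fintype.card_fin, nsmul_eq_mul,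
            show (3 * n + 1 : ℝ) = n + (2 * n + 1) by ring, Real.rpow_add (by norm_num) (n : ℝ),
            Real.rpow_natCast]
          push_cast
          rfl
  · intro M' hMM' hM'sub hhit
    have hM'board : M' ⊆ completeHypergraph n k :=
      hM'sub.trans (union_subset Subset.rfl hpos.maker_subset)
    have hsmall : ∀ S : Finset (Fin n), S.Nonempty → #S ≤ t → ∃ e ∈ M', #(e ∩ S) = 1 := by
      intro S hS hSt
      obtain ⟨v, -, e, he, heS⟩ := exists_inter_eq_singleton_of_sum_failureWeight_lt hp _ own hserve
        hpos.failure (S := S) (mem_filter.2 ⟨mem_univ _, hS, hSt⟩)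
      exact ⟨e, hMM' (hpos.own_subset v he), by rw [heS, card_singleton]⟩
    refine hasFullRank_of_odd_inter hn (fun e he => mem_completeHypergraph.1 (hM'board he))
      fun S hS hSk => ?_
    rcases Nat.lt_or_ge t #S with h1 | h1
    · by_cases h2 : Odd k ∨ t < #Sᶜ
      · obtain ⟨e, he, heM⟩ := not_disjoint_iff.1 (hhit S (mem_filter.2 ⟨mem_univ _, h1, h2⟩))
        exact ⟨e, heM, (mem_filter.1 he).2⟩
      -- For even `k` an edge meets `S` and its complement in sets of equal parity.
      · push Not at h2
        have hne : Sᶜ.Nonempty := by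
          rw [nonempty_iff_ne_empty]
          intro h0
          exact h2.1 (hSk (by simpa using h0))
        obtain ⟨e, he, hcard⟩ := hsmall Sᶜ hne h2.2
        refine ⟨e, he, ?_⟩
        have h3 := mem_completeHypergraph.1 (hM'board he)
        have h4 : #(e ∩ S) + #(e ∩ Sᶜ) = #e := by
          rw [← sdiff_eq_inter_compl]; exact card_inter_add_card_sdiff e S
        have h5 := Nat.not_odd_iff_even.1 h2.1
        rw [← h3, ← h4, hcard, Nat.even_add_one, Nat.not_even_iff_odd] at h5
        exact h5
    · obtain ⟨e, he, hcard⟩ := hsmall S hS h1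
      exact ⟨e, he, by rw [hcard]; exact odd_one⟩

theorem makerWins_of_parameters {n k b t : ℕ} (hn : 1 ≤ n) (hk : 2 ≤ k) {lam c h δ q : ℝ}
    (hlam : 0 < lam) (hc : 0 ≤ c) (hh : 0 < h) (hδ : 0 < δ) (hq : 0 < q) (hbq : (b : ℝ) ≤ q)
    (hlamb : lam * (b + 1) ≤ 1 - Real.exp (-c))
    (hdeg : h + (Real.log n + 2 * c) / lam + k * ((2 * n + 1) * (b + 1)) / h *
      (n - 2).choose (k - 2) + (b + 1) + δ ≤ (n - 1).choose (k - 1))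
    (hsmall : ∑ S : Finset (Fin n) with S.Nonempty ∧ #S ≤ t,
      (#S * (n - 2).choose (k - 2) / δ : ℝ) ^ (2 * #S) < 1)
    (hlarge : ∀ S : Finset (Fin n), t < #S → (Odd k ∨ t < #Sᶜ) →
      q * (3 * n + 1) < #((completeHypergraph n k).filter fun e => Odd #(e ∩ S))) :
    MakerWinsMatrixRankGame n k b := by
  have main : ∀ r : ℕ, ∀ M B C own, 2 * n - #M = r →
      IsServicePosition n k b t lam c h (fun S => #S * (n - 2).choose (k - 2) / δ) M B C own →
      ∀ F, F ⊆ freeEdges (completeHypergraph n k) M B → #F ≤ b →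
        MakerWinsFrom (completeHypergraph n k) b (HasFullRank n k) M (B ∪ F) := by
    intro r
    induction r using Nat.strong_induction_on with
    | _ r ih =>
      intro M B C own hr hpos F hF hFb
      by_cases hserve : ∃ v, #(own v) < 2
      · obtain ⟨e, he, own', hpos'⟩ := hpos.exists_move hk hlam hc hh hδ hlamb hdeg hserve hF hFb
        refine .round _ _ e he fun F' hF' => ?_
        have heM : e ∉ M := fun h => (mem_sdiff.1 he).2 (mem_union_left _ h)
        have hcard := hpos'.card_maker_le
        rw [card_insert_of_notMem heM] at hcard
        refine ih (2 * n - #(insert e M)) ?_ _ _ _ _ rfl hpos' F' hF'.1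
          (hF'.2.le.trans (min_le_left _ _))
        rw [card_insert_of_notMem heM]
        omega
      · push Not at hserve
        exact hpos.makerWinsFrom hn (fun S => by positivity) hq hbq hlarge hserve hFb
  have h0 : IsServicePosition n k b t lam c h (fun S => #S * (n - 2).choose (k - 2) / δ)
      ∅ ∅ ∅ (fun _ => ∅) := by
    constructor
    · exact empty_subset _
    · exact empty_subset _
    · exact empty_subset _
    · simp
    · simp
    · simp
    · simp
    · simp
    · have : ∀ v : Fin n, v ∉ dangerous h (∅ : Finset (Finset (Fin n))) := by
        intro v; simp [dangerous, not_le.2 hh]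
      simp [dangerWeight, this]
    · refine lt_of_le_of_lt (sum_le_sum fun S _ => ?_) hsmall
      simp [failureWeight, ← pow_mul]
  have := main _ ∅ ∅ ∅ _ rfl h0 ∅ (empty_subset _) (by simp)
  simpa [MakerWinsMatrixRankGame] using this

/-! ### Maker's side of the threshold -/

/-- There are at most `n ^ s / s!` sets of size `s`, and by `s ^ s ≤ 3 ^ s * s!` their terms add up to at
most `(1 / 4) ^ s`. -/
theorem sum_small_sets_lt_one {n t : ℕ} {A : ℝ} (hA : 0 ≤ A) (hn : 1 ≤ n) (ht : 12 * A ^ 2 * t ≤ n) :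
    ∑ S : Finset (Fin n) with S.Nonempty ∧ #S ≤ t, (A * #S / n : ℝ) ^ (2 * #S) < 1 := by
  have hn0 : (0 : ℝ) < n := by exact_mod_cast hn
  set f : ℕ → ℝ := fun s => if 1 ≤ s ∧ s ≤ t then (A * s / n : ℝ) ^ (2 * s) else 0 with hf
  have h1 : ∑ S : Finset (Fin n) with S.Nonempty ∧ #S ≤ t, (A * #S / n : ℝ) ^ (2 * #S) =
      ∑ s ∈ range (n + 1), (n.choose s : ℝ) * f s := by
    have := sum_powerset_apply_card f (x := (univ : Finset (Fin n)))
    rw [powerset_univ, card_univ, Fintype.card_fin] at this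
    simp only [nsmul_eq_mul] at this
    rw [← this, sum_filter]
    refine sum_congr rfl fun S _ => ?_
    simp only [hf, one_le_card]
  have hterm : ∀ s, (n.choose s : ℝ) * f s ≤ if 1 ≤ s then (1 / 4 : ℝ) ^ s else 0 := by
    intro s
    simp only [hf]
    by_cases hs : 1 ≤ s ∧ s ≤ t
    · rw [if_pos hs, if_pos hs.1]
      have a1 : (n.choose s : ℝ) ≤ (n : ℝ) ^ s / (s.factorial : ℝ) := Nat.choose_le_pow_div s n
      have a2 : (s : ℝ) ^ s / s.factorial ≤ 3 ^ s := by
        refine (Real.pow_div_factorial_le_exp (s : ℝ) (Nat.cast_nonneg s) s).trans ?_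
        rw [← Real.exp_one_pow]
        exact pow_le_pow_left₀ (Real.exp_pos _).le (by linarith [Real.exp_one_lt_d9]) _
      calc (n.choose s : ℝ) * (A * s / n) ^ (2 * s)
          ≤ (n : ℝ) ^ s / (s.factorial : ℝ) * (A * s / n) ^ (2 * s) := by gcongr
        _ = (s : ℝ) ^ s / s.factorial * (A ^ 2 * s / n) ^ s := by
            rw [pow_mul, div_pow, div_pow, div_pow, mul_pow, mul_pow, mul_pow, ← pow_mul (s : ℝ),
              ← pow_mul (n : ℝ), show 2 * s = s + s by ring, pow_add, pow_add]
            field_simp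
        _ ≤ 3 ^ s * (A ^ 2 * s / n) ^ s := by gcongr
        _ = (3 * (A ^ 2 * s / n)) ^ s := by rw [mul_pow]
        _ ≤ (1 / 4) ^ s := by
            gcongr
            rw [mul_div_assoc', div_le_iff₀ hn0]
            have : (s : ℝ) ≤ t := by exact_mod_cast hs.2
            have := mul_le_mul_of_nonneg_left this (sq_nonneg A)
            linarith
    · rw [if_neg hs, mul_zero]
      split_ifs <;> positivity
  have hgeom : ∀ m : ℕ, ∑ s ∈ range (m + 1), (if 1 ≤ s then (1 / 4 : ℝ) ^ s else 0) ≤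
      1 / 3 - 1 / 3 * (1 / 4) ^ m := by
    intro m
    induction m with
    | zero => simp
    | succ m ih =>
      rw [sum_range_succ, if_pos (by omega), pow_succ]
      linarith
  rw [h1]
  have h2 := sum_le_sum fun s (_ : s ∈ range (n + 1)) => hterm s
  have h3 := hgeom n
  have h4 : (0 : ℝ) < (1 / 4) ^ n := by positivity
  linarith

theorem choose_le_card_odd_inter {n k : ℕ} (hk : Odd k) (S : Finset (Fin n)) :
    (#S).choose k ≤ #((completeHypergraph n k).filter fun e => Odd #(e ∩ S)) := by
  rw [← card_powersetCard]
  refine card_le_card fun e he => ?_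
  rw [mem_powersetCard] at he
  refine mem_filter.2 ⟨mem_completeHypergraph.2 he.2, ?_⟩
  rwa [inter_eq_left.2 he.1, he.2]

theorem mul_choose_le_card_odd_inter {n k : ℕ} (hk : 1 ≤ k) (S : Finset (Fin n)) :
    #S * (#Sᶜ).choose (k - 1) ≤ #((completeHypergraph n k).filter fun e => Odd #(e ∩ S)) := by
  rw [← card_powersetCard, ← card_product]
  have hinter : ∀ x ∈ S ×ˢ powersetCard (k - 1) Sᶜ, insert x.1 x.2 ∩ S = {x.1} ∧
      insert x.1 x.2 \ S = x.2 := by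
    intro x hx
    rw [mem_product, mem_powersetCard] at hx
    have hdisj : Disjoint x.2 S := (le_compl_iff_disjoint_right).1 hx.2.1
    rw [insert_inter_of_mem hx.1, disjoint_iff_inter_eq_empty.1 hdisj, insert_sdiff_of_mem _ hx.1,
      sdiff_eq_self_of_disjoint hdisj]
    exact ⟨rfl, rfl⟩
  refine card_le_card_of_injOn (fun x => insert x.1 x.2) (fun x hx => ?_) fun x hx y hy hxy => ?_
  · have h1 := (hinter x hx).1
    rw [mem_coe, mem_product, mem_powersetCard] at hx
    have h2 : x.1 ∉ x.2 := fun h => (mem_compl.1 (hx.2.1 h)) hx.1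
    refine mem_filter.2 ⟨mem_completeHypergraph.2 ?_, ?_⟩
    · rw [card_insert_of_notMem h2, hx.2.2]; omega
    · simp [h1]
  · have h1 := hinter x hx
    have h2 := hinter y hy
    simp only at hxy
    refine Prod.ext (singleton_injective ?_) ?_
    · rw [← h1.1, ← h2.1, hxy]
    · rw [← h1.2, ← h2.2, hxy]

theorem pow_div_factorial_le_choose {k s : ℕ} {y : ℝ} (hy : 0 ≤ y) (h : y + k ≤ s) :
    y ^ k / k.factorial ≤ (s.choose k : ℝ) := by
  have hks : k ≤ s := by exact_mod_cast (by linarith : (k : ℝ) ≤ s)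
  refine le_trans ?_ (Nat.pow_le_choose k s)
  gcongr
  rw [Nat.cast_sub (by omega)]
  push_cast
  linarith

/-- The number of edges that meet a set of linear size in an odd number of vertices has the order of
magnitude `n ^ k`. -/
theorem pow_div_factorial_le_card_odd_inter {n k : ℕ} (hk : 1 ≤ k) {y : ℝ} (hy : 0 ≤ y)
    {S : Finset (Fin n)} (hS : y + k ≤ #S) (hS' : Odd k ∨ y + k ≤ #Sᶜ) :
    y ^ k / k.factorial ≤ (#((completeHypergraph n k).filter fun e => Odd #(e ∩ S)) : ℝ) := by
  by_cases hodd : Odd k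
  · refine (pow_div_factorial_le_choose hy hS).trans ?_
    exact_mod_cast choose_le_card_odd_inter hodd S
  · have h1 := hS'.resolve_left hodd
    obtain ⟨j, rfl⟩ : ∃ j, k = j + 1 := ⟨k - 1, by omega⟩
    push_cast at h1 hS
    have h2 : y ^ j / j.factorial ≤ ((#Sᶜ).choose j : ℝ) :=
      pow_div_factorial_le_choose hy (by linarith)
    calc y ^ (j + 1) / (j + 1).factorial ≤ y ^ (j + 1) / j.factorial := by
          gcongr; omega
      _ = y * (y ^ j / j.factorial) := by rw [pow_succ]; ring
      _ ≤ #S * ((#Sᶜ).choose j : ℝ) := by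
          gcongr
          have : (0 : ℝ) ≤ j := Nat.cast_nonneg j
          linarith
      _ ≤ _ := by exact_mod_cast mul_choose_le_card_odd_inter hk S

/-- The degree condition of `makerWins_of_parameters`, with all terms measured in units of
`N = n.choose (k - 1)`. -/
theorem degree_budget {ε N L n κ b k c D : ℝ} (hε : 0 < ε) (hε1 : ε ≤ 1) (hN : 0 < N) (hL : 0 < L)
    (hn : 1 ≤ n) (hκ0 : 0 ≤ κ) (hκ : n * κ ≤ k * N) (hb0 : 0 ≤ b) (hb : b + 1 ≤ N / L) (hk : 1 ≤ k)
    (hD : N - k * N / n ≤ D) (h1 : 200 * c ≤ ε * L)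
    (h2 : 6000 * k ^ 2 ≤ ε ^ 2 * L) (h3 : 100 * k ≤ ε * n) :
    ε / 20 * N + (L + 2 * c) / ((1 + ε / 2) * L / N) +
      k * ((2 * n + 1) * (b + 1)) / (ε / 20 * N) * κ + (b + 1) + ε / 8 * N ≤ D := by
  have hn0 : 0 < n := by linarith
  have a1 : (L + 2 * c) / ((1 + ε / 2) * L / N) ≤ N * (1 - ε / 3 + ε / 100) := by
    rw [div_le_iff₀ (by positivity)]
    have e1 : N * (1 - ε / 3 + ε / 100) * ((1 + ε / 2) * L / N) =
        (1 - ε / 3 + ε / 100) * (1 + ε / 2) * L := by field_simp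
    rw [e1]
    have e2 : 1 + ε / 100 ≤ (1 - ε / 3 + ε / 100) * (1 + ε / 2) := by nlinarith
    have e3 := mul_le_mul_of_nonneg_right e2 hL.le
    linarith
  have hL2 : N / L ≤ N * (ε / 100) := by
    rw [div_le_iff₀ hL]
    have e1 : 1 ≤ ε / 100 * L := by
      have : ε ^ 2 * L ≤ ε * L := by
        gcongr
        nlinarith
      nlinarith
    nlinarith
  have a2 : k * ((2 * n + 1) * (b + 1)) / (ε / 20 * N) * κ ≤ N * (ε / 100) := by
    calc k * ((2 * n + 1) * (b + 1)) / (ε / 20 * N) * κ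
        ≤ k * ((3 * n) * (N / L)) / (ε / 20 * N) * κ := by
          gcongr; linarith
      _ = 60 * k / (ε * L) * (n * κ) := by field_simp; ring
      _ ≤ 60 * k / (ε * L) * (k * N) := by gcongr
      _ = 60 * k ^ 2 / (ε * L) * N := by ring
      _ ≤ ε / 100 * N := by
          refine mul_le_mul_of_nonneg_right ?_ hN.le
          rw [div_le_iff₀ (by positivity)]
          nlinarith
      _ = _ := by ring
  have a3 : k * N / n ≤ N * (ε / 100) := by
    rw [div_le_iff₀ hn0]
    nlinarith
  nlinarith [mul_pos hN hε]

theorem choose_sub_div_le {n k : ℕ} (hn : 1 ≤ n) (hk : 2 ≤ k) :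
    (n.choose (k - 1) : ℝ) - k * n.choose (k - 1) / n ≤ ((n - 1).choose (k - 1) : ℝ) := by
  have hn0 : (0 : ℝ) < n := by exact_mod_cast hn
  have h1 : n.choose (k - 1) = (n - 1).choose (k - 2) + (n - 1).choose (k - 1) := by
    obtain ⟨m, rfl⟩ : ∃ m, n = m + 1 := ⟨n - 1, by omega⟩
    obtain ⟨j, rfl⟩ : ∃ j, k = j + 2 := ⟨k - 2, by omega⟩
    exact Nat.choose_succ_succ' m j
  have h2 : n * (n - 1).choose (k - 2) ≤ k * n.choose (k - 1) :=
    (mul_choose_pred_pred hn hk).le.trans (Nat.mul_le_mul_right _ (Nat.sub_le _ _))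
  have h3 : (n : ℝ) * (n - 1).choose (k - 2) ≤ k * n.choose (k - 1) := by exact_mod_cast h2
  have h4 : ((n - 1).choose (k - 2) : ℝ) ≤ k * n.choose (k - 1) / n := by
    rw [le_div_iff₀ hn0]; linarith
  have h5 : (n.choose (k - 1) : ℝ) = (n - 1).choose (k - 2) + (n - 1).choose (k - 1) := by
    exact_mod_cast h1
  linarith

open Filter Topology in
/-- The choice `lam = (1 + ε / 2) * log n / N` and `exp (-c) = ε / 4` makes the total weight nonincreasing
for `b ≤ (1 - ε) * N / log n`, and it lets no vertex in need reach degree `(1 - ε / 8) * N`. -/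
theorem makerWins_of_small_bias_of_two_le {k : ℕ} (hk : 2 ≤ k) {ε : ℝ} (hε : 0 < ε) (hε1 : ε ≤ 1) :
    ∀ᶠ n : ℕ in atTop, ∀ b : ℕ, (b : ℝ) ≤ (1 - ε) * (n.choose (k - 1) : ℝ) / Real.log n →
      MakerWinsMatrixRankGame n k b := by
  have hcast := tendsto_natCast_atTop_atTop (R := ℝ)
  have hlog := Real.tendsto_log_atTop.comp hcast
  have hk2 : (2 : ℝ) ≤ k := by exact_mod_cast hk
  set A : ℝ := 8 * k / ε with hA
  have hA0 : 0 < A := by positivity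
  -- Sets of at most `c₀ * n` vertices are dealt with by serving all vertices.
  set c₀ : ℝ := 1 / (12 * A ^ 2) with hc₀
  have hc₀0 : 0 < c₀ := by positivity
  set γ : ℝ := (c₀ / 2) ^ k / k.factorial with hγ
  have hγ0 : 0 < γ := by positivity
  set c : ℝ := Real.log (4 / ε) with hc
  have hc0 : 0 ≤ c := Real.log_nonneg (by rw [le_div_iff₀ hε]; linarith)
  have hexpc : Real.exp (-c) = ε / 4 := by
    rw [Real.exp_neg, hc, Real.exp_log (by positivity), inv_div]
  filter_upwards [hlog.eventually_ge_atTop (200 * c / ε), hlog.eventually_ge_atTop (6000 * k ^ 2 / ε ^ 2),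
    hlog.eventually_gt_atTop (4 / γ), hcast.eventually_ge_atTop (100 * k / ε),
    hcast.eventually_ge_atTop (2 * k / c₀), eventually_ge_atTop (k + 2),
    (tendsto_log_mul_rpow_neg one_pos).eventually_le_const (by positivity : 0 < ε / 6)]
    with n h1 h2 h3 h4 h5 hn h6 b hb
  simp only [Function.comp] at h1 h2 h3
  set L := Real.log n with hL
  set N : ℝ := (n.choose (k - 1) : ℝ) with hN
  have hL0 : 0 < L := lt_trans (by positivity) h3
  have hn0 : (0 : ℝ) < n := by exact_mod_cast (by omega : 0 < n)
  have hNn : (n : ℝ) ≤ N := by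
    rw [hN]
    exact_mod_cast le_choose_of_pos_of_lt (show 1 ≤ k - 1 by omega) (show k - 1 < n by omega)
  have hN0 : 0 < N := hn0.trans_le hNn
  rw [Real.rpow_neg_one, ← div_eq_mul_inv, div_le_iff₀ hn0] at h6
  have hLN : L ≤ ε / 6 * N := h6.trans (by gcongr)
  rw [div_le_iff₀ (by positivity)] at h1 h2 h4 h5
  rw [div_lt_iff₀ hγ0] at h3
  have hκN : (n : ℝ) * (n - 2).choose (k - 2) ≤ k * N := by
    have h : (n * (n - 2).choose (k - 2) : ℕ) ≤ k * n.choose (k - 1) :=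
      (mul_choose_codegree_le (by omega) hk).trans (Nat.mul_le_mul_right _ (Nat.sub_le _ _))
    rw [hN]
    exact_mod_cast h
  have hbL : b * L ≤ (1 - ε) * N := by rwa [le_div_iff₀ hL0] at hb
  have hb1 : (b : ℝ) + 1 ≤ N / L := by
    rw [le_div_iff₀ hL0]
    nlinarith
  have ht : ((⌊c₀ * n⌋₊ : ℕ) : ℝ) ≤ c₀ * n := Nat.floor_le (by positivity)
  refine makerWins_of_parameters (t := ⌊c₀ * n⌋₊) (lam := (1 + ε / 2) * L / N) (c := c)
    (h := ε / 20 * N) (δ := ε / 8 * N) (q := N / L) (by omega) hk (by positivity) hc0 (by positivity)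
    (by positivity) (by positivity) (by linarith) ?_ ?_ ?_ ?_
  · rw [hexpc, div_mul_eq_mul_div, div_le_iff₀ hN0]
    have : L * (b + 1) ≤ (1 - ε) * N + ε / 6 * N := by linarith
    have := mul_le_mul_of_nonneg_left this (by positivity : 0 ≤ 1 + ε / 2)
    nlinarith [mul_pos hN0 hε, mul_pos (mul_pos hN0 hε) hε]
  · exact degree_budget hε hε1 hN0 hL0 (by exact_mod_cast (by omega : 1 ≤ n)) (Nat.cast_nonneg _) hκN
      (Nat.cast_nonneg _) hb1 (by linarith) (choose_sub_div_le (by omega) hk) (by linarith)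
      (by linarith) (by linarith)
  · refine lt_of_le_of_lt (sum_le_sum fun S _ => ?_)
      (sum_small_sets_lt_one (n := n) (t := ⌊c₀ * n⌋₊) hA0.le (by omega) ?_)
    · refine pow_le_pow_left₀ (by positivity) ?_ _
      rw [div_le_div_iff₀ (by positivity) hn0, hA]
      calc (#S : ℝ) * (n - 2).choose (k - 2) * n = #S * (n * (n - 2).choose (k - 2)) := by ring
        _ ≤ #S * (k * N) := by gcongr
        _ = 8 * k / ε * #S * (ε / 8 * N) := by field_simp
    · calc 12 * A ^ 2 * ((⌊c₀ * n⌋₊ : ℕ) : ℝ) ≤ 12 * A ^ 2 * (c₀ * n) := by gcongr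
        _ = (n : ℝ) := by rw [hc₀]; field_simp
  · intro S hS hS'
    have hlin : ∀ s : ℕ, ⌊c₀ * n⌋₊ < s → c₀ * n / 2 + k ≤ s := fun s hs => by
      have := (Nat.floor_lt (by positivity)).1 hs
      linarith
    refine lt_of_lt_of_le ?_ (pow_div_factorial_le_card_odd_inter (y := c₀ * n / 2) (by omega)
      (by positivity) (hlin _ hS) (hS'.imp_right (hlin _)))
    have e1 : (c₀ * n / 2) ^ k / k.factorial = γ * (n : ℝ) ^ k := by
      rw [hγ, show c₀ * (n : ℝ) / 2 = c₀ / 2 * n by ring, mul_pow]; ring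
    have e2 : N ≤ (n : ℝ) ^ (k - 1) := by
      rw [hN]; exact_mod_cast Nat.choose_le_pow n (k - 1)
    have e3 : (n : ℝ) ^ k = (n : ℝ) ^ (k - 1) * n := by
      rw [← pow_succ]; congr 1; omega
    rw [e1, e3, div_mul_eq_mul_div, div_lt_iff₀ hL0]
    have hn1 : (1 : ℝ) ≤ n := by exact_mod_cast (by omega : 1 ≤ n)
    calc N * (3 * n + 1) ≤ (n : ℝ) ^ (k - 1) * (4 * n) := by gcongr; linarith
      _ = (n : ℝ) ^ (k - 1) * n * 4 := by ring
      _ < (n : ℝ) ^ (k - 1) * n * (L * γ) := by gcongr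
      _ = _ := by ring

/-- For `k = 1` a bias below the threshold is `0`, and Maker claims all vertices. -/
theorem makerWins_of_one {n : ℕ} (hn : 1 ≤ n) : MakerWinsMatrixRankGame n 1 0 := by
  refine makerWinsFrom_of_invariant (fun M B => M ⊆ completeHypergraph n 1 ∧ B = ∅) ?_ ?_ ∅ ∅
    ⟨empty_subset _, rfl⟩
  · rintro M B ⟨hM, rfl⟩ hfree
    rw [freeEdges, union_empty, sdiff_eq_empty_iff_subset] at hfree
    refine hasFullRank_of_odd_inter hn (fun e he => mem_completeHypergraph.1 (hM he)) fun S hS _ => ?_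
    obtain ⟨v, hv⟩ := hS
    exact ⟨{v}, hfree (mem_completeHypergraph.2 (card_singleton v)), by
      rw [singleton_inter_of_mem hv, card_singleton]; exact odd_one⟩
  · rintro M B ⟨hM, rfl⟩ ⟨e, he⟩
    refine ⟨e, he, fun F hF => ⟨insert_subset (mem_sdiff.1 he).1 hM, ?_⟩⟩
    rw [empty_union, ← card_eq_zero, hF.2, Nat.zero_min]

open Filter in
theorem makerWins_of_small_bias {k : ℕ} (hk : 1 ≤ k) {ε : ℝ} (hε : 0 < ε) :
    ∀ᶠ n : ℕ in atTop, ∀ b : ℕ, (b : ℝ) ≤ (1 - ε) * (n.choose (k - 1) : ℝ) / Real.log n →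
      MakerWinsMatrixRankGame n k b := by
  rcases hk.eq_or_lt with rfl | hk
  · filter_upwards [eventually_ge_atTop 3] with n hn b hb
    have hlog : 1 < Real.log n := by
      rw [Real.lt_log_iff_exp_lt (by exact_mod_cast (by omega : 0 < n))]
      have : (3 : ℝ) ≤ n := by exact_mod_cast hn
      linarith [Real.exp_one_lt_d9]
    have hb1 : (b : ℝ) < 1 := by
      refine hb.trans_lt ?_
      rw [div_lt_one (by linarith)]
      simp only [Nat.sub_self, Nat.choose_zero_right, Nat.cast_one, mul_one]
      linarith
    have hb0 : b = 0 := by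
      have : b < 1 := by exact_mod_cast hb1
      omega
    subst hb0
    exact makerWins_of_one (by omega)
  · filter_upwards [makerWins_of_small_bias_of_two_le hk (lt_min hε one_pos) (min_le_right ε 1),
      eventually_ge_atTop 2] with n h hn b hb
    refine h b (hb.trans ?_)
    have : 0 < Real.log n := Real.log_pos (by exact_mod_cast hn)
    gcongr
    exact min_le_left _ _

theorem theorem2 (k : ℕ) (hk : 1 ≤ k) (ε : ℝ) (hε : 0 < ε) :
    ∃ n₀ : ℕ, ∀ n : ℕ, n₀ ≤ n → ∀ (b : ℕ) (β : ℝ),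
      (b : ℝ) = β * (n.choose (k - 1) : ℝ) / Real.log (n : ℝ) →
        (β ≤ 1 - ε → MakerWinsMatrixRankGame n k b) ∧
        (1 + ε ≤ β → BreakerWinsMatrixRankGame n k b) := by
  rw [← Filter.eventually_atTop]
  filter_upwards [makerWins_of_small_bias hk hε, breakerWins_of_large_bias hk hε] with n hM hB b β hb
  have hlog : 0 ≤ Real.log n := Real.log_natCast_nonneg n
  refine ⟨fun hβ => hM b ?_, fun hβ => hB b ?_⟩
  · rw [hb]; gcongr
  · rw [hb]; gcongr
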